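/- Let $K$ be an algebraically closed field of characteristic $p\ge 0$ (for $p=0$ we agree that $p$ divides no positive integer). Let $\psi=(x(t),y(t))$, with $x(t),y(t)\in tK[[t]]$ not both zero, be a parametrization of a plane branch over $K$, identified with the $K$-algebra morphism $K[[x,y]]\to K[[t]]$, $x\mapsto x(t)$, $y\mapsto y(t)$. Assume that $\psi$ is primitive, i.e. $\dim_K K[[t]]/K[[x(t),y(t)]]<\infty$. Two parametrizations $\psi,\varphi$ are $\mathcal A$-equivalent, $\psi\sim_{\mathcal A}\varphi$, if $\varphi=r\circ\psi\circ l^{-1}$ for $K$-algebra automorphisms $l$ of $K[[x,y]]$ and $r$ of $K[[t]]$. Let $\Gamma=\{\operatorname{ord}_t h\mid 0\ne h\in K[[x(t),y(t)]]\}\subseteq\mathbb N$ be the semigroup of $\psi$ and $c=\min\{n\in\Gamma\mid n+m\in\Gamma\ \text{for all } m\ge 0\}$ its conductor. Assume that the branch is singular, i.e. $1\notin\Gamma$. Then the multiplicity $a=\min(\Gamma\setminus\{0\})$ and the number $b=\min\{n\in\Gamma\mid a\nmid n\}$ exist, and $a<b$, $a\nmid b$. If $\operatorname{ord}_t x(t)<\operatorname{ord}_t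 y(t)$, then $\operatorname{ord}_t x(t)=a$, and if moreover $\operatorname{ord}_t y(t)$ is finite and not divisible by $a$, then $\operatorname{ord}_t y(t)=b$. Furthermore, there are in each of the following cases coefficients $a_i,b_i\in K$ (depending on the case), where the sums in the first component run only over $i>a$ and those in the second component only over $i>b$, such that: 1. In general, $(x(t),y(t))\sim_{\mathcal A}\bigl(t^a+\sum_{i\notin\Gamma}a_it^i,\ t^b+\sum_{i\notin\Gamma}b_it^i\bigr)$. If $p\nmid a$, then $(x(t),y(t))\sim_{\mathcal A}\bigl(t^a,\ t^b+\sum_{i\notin\Gamma}b_it^i\bigr)$. If $p\nmid b$, then $(x(t),y(t))\sim_{\mathcal A}\bigl(t^a+\sum_{i\notin\Gamma}a_it^i,\ t^b\bigr)$. 2. Let $a>2$. If $p\nmid b$, then $(x(t),y(t))\sim_{\mathcal A}\bigl(t^a+\sum_{i\notin\Gamma}a_it^i,\ t^b+\sum_{i\notin\Gamma,\,i<c-1}b_it^i\bigr)$. If $p\nmid a$, then $(x(t),y(t))\sim_{\mathcal A}\bigl(t^a+\sum_{i\notin\Gamma,\,i<c-1}a_it^i,\ t^b+\sum_{i\notin\Gamma}b_it^i\bigr)$.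 3. If $a>2$, $p\nmid a$ and $p\nmid b$, then $(x(t),y(t))\sim_{\mathcal A}\bigl(t^a,\ t^b+\sum_{i\notin\Gamma,\,i<c-1}b_it^i\bigr)$ and $(x(t),y(t))\sim_{\mathcal A}\bigl(t^a+\sum_{i\notin\Gamma,\,i<c-1}a_it^i,\ t^b\bigr)$. -/

import Mathlib

/-- A parametrization `(x(t), y(t))` of an algebroid plane curve over `K`: two power series without
constant term, not both zero. -/
structure PlaneParam (K : Type*) [Field K] where
  x : PowerSeries K
  y : PowerSeries K
  constantCoeff_x : PowerSeries.constantCoeff x = 0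
  constantCoeff_y : PowerSeries.constantCoeff y = 0
  ne_zero : x ≠ 0 ∨ y ≠ 0

namespace PlaneParam

variable {K : Type*} [Field K]

theorem hasSubst (ψ : PlaneParam K) :
    MvPowerSeries.HasSubst (S := K) (τ := Unit) ![ψ.x, ψ.y] := by
  apply MvPowerSeries.hasSubst_of_constantCoeff_zero
  intro i
  fin_cases i
  · exact ψ.constantCoeff_x
  · exact ψ.constantCoeff_y

/-- The morphism `K[[x,y]] → K[[t]]`, `h ↦ h(x(t), y(t))`, belonging to a parametrization. -/
noncomputable def hom (ψ : PlaneParam K) : MvPowerSeries (Fin 2) K →ₐ[K] PowerSeries K :=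
  MvPowerSeries.substAlgHom ψ.hasSubst

/-- The subring `K[[x(t), y(t)]]` of `K[[t]]`. -/
noncomputable def ring (ψ : PlaneParam K) : Subalgebra K (PowerSeries K) :=
  ψ.hom.range

/-- `ψ` is primitive: `K[[t]] / K[[x(t), y(t)]]` has finite dimension over `K`. -/
def IsPrimitive (ψ : PlaneParam K) : Prop :=
  Module.Finite K (PowerSeries K ⧸ Subalgebra.toSubmodule ψ.ring)

/-- The semigroup of values: the orders of the nonzero elements of `K[[x(t), y(t)]]`. -/
def semigroup (ψ : PlaneParam K) : Set ℕ :=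
  {n | ∃ h ∈ ψ.ring, h.order = (n : ℕ∞)}

/-- The conductor: the least `n` in the semigroup such that `n + m` is in it for all `m ≥ 0`
(it exists for a primitive parametrization). -/
noncomputable def conductor (ψ : PlaneParam K) : ℕ :=
  sInf {n | n ∈ ψ.semigroup ∧ ∀ m, n + m ∈ ψ.semigroup}

/-- Left-right equivalence: the morphisms of `ψ` and `φ` differ by `K`-algebra automorphisms of
`K[[x,y]]` and of `K[[t]]`. -/
def AEquiv (ψ φ : PlaneParam K) : Prop :=
  ∃ (l : MvPowerSeries (Fin 2) K ≃ₐ[K] MvPowerSeries (Fin 2) K)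
    (r : PowerSeries K ≃ₐ[K] PowerSeries K),
    φ.hom = (r : PowerSeries K →ₐ[K] PowerSeries K).comp
      (ψ.hom.comp (l.symm : MvPowerSeries (Fin 2) K →ₐ[K] MvPowerSeries (Fin 2) K))

/-- `ψ` is left-right equivalent to the parametrization `(u(t), v(t))`. -/
def AEquivTo (ψ : PlaneParam K) (u v : PowerSeries K) : Prop :=
  ∃ φ : PlaneParam K, ψ.AEquiv φ ∧ φ.x = u ∧ φ.y = v

/-- The power series `t ^ m + ∑ i ∈ S, i > m, α i * t ^ i`. -/
noncomputable def powAdd (m : ℕ) (S : Set ℕ) (α : ℕ → K) : PowerSeries K :=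
  PowerSeries.X ^ m + PowerSeries.mk ({i | i ∈ S ∧ m < i}.indicator α)

/-- The gaps of the semigroup. -/
def gaps (ψ : PlaneParam K) : Set ℕ := {i | i ∉ ψ.semigroup}

/-- The gaps `i` with `i < c - 1`, where `c` is the conductor. -/
def smallGaps (ψ : PlaneParam K) : Set ℕ := {i | i ∉ ψ.semigroup ∧ i + 1 < ψ.conductor}

end PlaneParam

/-! Write `R = K[[x(t), y(t)]]`. Primitivity puts a power of the maximal ideal of `K[[t]]` inside
`R`, so `Γ` has a conductor `c` and `t^c K[[t]] ⊆ R`. Subtracting a series `F(x)` from `y` makes the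
orders of the components `a` and `b`, with `a` not dividing `b`. Elements of `R` are `F(x) + yQ`,
where `F(x)` has order in `aℕ` and `yQ` has order at least `b`; hence `a` and `b` are the invariants
of `Γ` in the statement. By the formal inverse function theorem, any two elements of `R` of orders
`a` and `b` form an equivalent parametrization (`IsAdapted.aequivTo`).

Each component may therefore be altered modulo `R` above its leading term, which removes all
exponents in `Γ`. If `p ∤ a`, then `x` is the `a`-th power of a series of order one; taking that
series as the new parameter gives `x = t^a`. The same works for `y` and `b`.

The exponent `c - 1` is removed by `t ↦ t + κt^(l+1) + ⋯`, which changes `t^n + ⋯` first in degree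
`n + l`, by a multiple of `nκ` (`X_pow_dvd_algEquiv_sub`). With `l = c - 1 - n` this cancels the
term of degree `c - 1`, and everything of order at least `c` lies in `R`.

To keep `x = t^a` at the same time, an element of `R` of order `a + l`, with `l = c - 1 - b`, is
first added to `x`; restoring `t^a` then forces the desired substitution. Such an element exists
because `b - a` is a gap and `Γ` is symmetric: `c - 1 - (b - a) = a + l` is a value. Symmetry comes
from Gorenstein duality for the monogenic extension `R = K[[x]][y]` of `K[[x]]`
(`PowerBasis.exists_dual`, `conductor_sub_mem_semigroup`). -/

/-- A ring endomorphism of a complete ring that is the identity modulo `I`, and the identity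
modulo `I ^ 2` on `I`, is bijective. -/
theorem RingHom.bijective_of_sub_mem_sq {A : Type*} [CommRing A] (I : Ideal A)
    [IsAdicComplete I A] (ρ : A →+* A) (h₀ : ∀ P, ρ P - P ∈ I)
    (h₁ : ∀ P ∈ I, ρ P - P ∈ I ^ 2) : Function.Bijective ρ := by
  -- `ρ - id` raises the `I`-adic order by one; on products this is a Leibniz-type identity.
  have key : ∀ n : ℕ, ∀ P ∈ I ^ n, ρ P - P ∈ I ^ (n + 1) := by
    intro n
    induction n with
    | zero => intro P _; simpa using h₀ P
    | succ n ih =>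
      intro P hP
      rw [pow_succ] at hP
      refine Submodule.mul_induction_on hP (fun m hm k hk => ?_) (fun x y hx hy => ?_)
      · have e : ρ (m * k) - m * k = ρ m * (ρ k - k) + (ρ m - m) * k := by
          rw [map_mul]; ring
        rw [e]
        have hm' : ρ m ∈ I ^ n := by
          have := add_mem (Ideal.pow_le_pow_right (Nat.le_succ n) (ih m hm)) hm
          simpa using this
        refine add_mem ?_ ?_
        · have := Ideal.mul_mem_mul hm' (h₁ k hk)
          rwa [← pow_add] at this
        · have := Ideal.mul_mem_mul (ih m hm) hk
          rwa [← pow_succ] at this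
      · have e : ρ (x + y) - (x + y) = (ρ x - x) + (ρ y - y) := by rw [map_add]; ring
        rw [e]; exact add_mem hx hy
  have haus : ∀ P : A, (∀ n, P ∈ I ^ n) → P = 0 := by
    intro P hP
    refine IsHausdorff.haus (I := I) (M := A) inferInstance P fun n => ?_
    rw [SModEq.zero]; simpa using hP n
  constructor
  · rw [injective_iff_map_eq_zero]
    intro P hP
    refine haus P fun n => ?_
    induction n with
    | zero => simp
    | succ n ih => simpa [hP] using key n P ih
  · intro F
    -- Successive approximation of a preimage of `F`: each step adds the current error, which then
    -- moves one power of `I` deeper.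
    let G : ℕ → A := fun n => Nat.rec 0 (fun _ g => g + (F - ρ g)) n
    have hG : ∀ n, G (n + 1) = G n + (F - ρ (G n)) := fun n => rfl
    have hF : ∀ n, F - ρ (G n) ∈ I ^ n := by
      intro n
      induction n with
      | zero => simp
      | succ n ih =>
        have e : F - ρ (G (n + 1)) = -(ρ (F - ρ (G n)) - (F - ρ (G n))) := by
          rw [hG, map_add]; ring
        rw [e]; exact neg_mem (key n _ ih)
    have hc : ∀ m n, m ≤ n → G m ≡ G n [SMOD (I ^ m • ⊤ : Submodule A A)] := by
      intro m n hmn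
      induction n, hmn using Nat.le_induction with
      | base => rfl
      | succ n hmn ih =>
        refine ih.trans ?_
        rw [SModEq.sub_mem, hG]
        simpa using (neg_mem (Ideal.pow_le_pow_right hmn (hF n)) : _ ∈ I ^ m)
    obtain ⟨L, hL⟩ := IsPrecomplete.prec (I := I) (M := A) inferInstance (fun {m n} h => hc m n h)
    refine ⟨L, ?_⟩
    refine (sub_eq_zero.mp (haus (F - ρ L) fun n => ?_)).symm
    have hn : G n - L ∈ I ^ n := by
      have := hL n
      rw [SModEq.sub_mem] at this
      simpa using this
    have e : F - ρ L = (F - ρ (G n)) + ((ρ (G n - L) - (G n - L)) + (G n - L)) := by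
      rw [map_sub]; ring
    rw [e]
    exact add_mem (hF n) (add_mem (Ideal.pow_le_pow_right (Nat.le_succ n) (key n _ hn)) hn)

/-! ### Power series in two variables: the inverse function theorem and uniqueness of morphisms -/

namespace MvPowerSeries

variable {K : Type*} [Field K]

/-- The ideal of `K[[x,y]]` generated by the variables. -/
noncomputable def varIdeal (K : Type*) [Field K] : Ideal (MvPowerSeries (Fin 2) K) :=
  Ideal.span (Set.range X)

theorem X_mem_varIdeal (i : Fin 2) : (X i : MvPowerSeries (Fin 2) K) ∈ varIdeal K :=
  Ideal.subset_span ⟨i, rfl⟩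

/-- The embedding `K[[x]] → K[[x,y]]`. -/
noncomputable def inX (K : Type*) [Field K] : PowerSeries K →ₐ[K] MvPowerSeries (Fin 2) K :=
  PowerSeries.substAlgHom (PowerSeries.HasSubst.X (0 : Fin 2))

@[simp]
theorem inX_X : inX K PowerSeries.X = X 0 :=
  PowerSeries.substAlgHom_X _

/-- The terms free of `y` form `F`. Under a parametrization this separates the values in `aℕ` from
the part divisible by `y(t)`. -/
theorem exists_eq_inX_add (P : MvPowerSeries (Fin 2) K) :
    ∃ (F : PowerSeries K) (Q : MvPowerSeries (Fin 2) K), P = inX K F + X 1 * Q := by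
  classical
  let F : PowerSeries K := PowerSeries.mk fun k => coeff (Finsupp.single 0 k) P
  have h : X (1 : Fin 2) ∣ P - inX K F := by
    rw [X_dvd_iff]
    intro m hm
    have hm' : m = Finsupp.single 0 (m 0) := by
      ext i; fin_cases i <;> simp [hm]
    rw [map_sub, inX, PowerSeries.coe_substAlgHom, PowerSeries.coeff_subst_single, if_pos hm']
    simp only [F, PowerSeries.coeff_mk]
    rw [← hm', sub_self]
  obtain ⟨Q, hQ⟩ := h
  exact ⟨F, Q, by rw [← hQ]; ring⟩

theorem exists_eq_C_add (P : MvPowerSeries (Fin 2) K) :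
    ∃ (c : K) (P₀ P₁ : MvPowerSeries (Fin 2) K),
      P = algebraMap K _ c + X 0 * P₀ + X 1 * P₁ := by
  obtain ⟨F, Q, rfl⟩ := exists_eq_inX_add P
  refine ⟨PowerSeries.constantCoeff F, inX K (PowerSeries.mk fun n => PowerSeries.coeff (n + 1) F),
    Q, ?_⟩
  conv_lhs => rw [PowerSeries.eq_X_mul_shift_add_const F]
  rw [map_add, map_mul, inX_X, add_comm (X 0 * _)]
  congr 2
  exact (inX K).commutes _

theorem mem_varIdeal_iff {P : MvPowerSeries (Fin 2) K} :
    P ∈ varIdeal K ↔ ∃ P₀ P₁, P = X 0 * P₀ + X 1 * P₁ := by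
  have : Set.range (X : Fin 2 → MvPowerSeries (Fin 2) K) = {X 0, X 1} := by
    ext z; simp [eq_comm]
  rw [varIdeal, this, Ideal.mem_span_pair]
  constructor
  · rintro ⟨a, b, h⟩; exact ⟨a, b, by rw [← h]; ring⟩
  · rintro ⟨a, b, h⟩; exact ⟨a, b, by rw [h]; ring⟩

theorem constantCoeff_eq_zero_of_mem_varIdeal {P : MvPowerSeries (Fin 2) K}
    (h : P ∈ varIdeal K) : constantCoeff P = 0 := by
  obtain ⟨a, b, rfl⟩ := mem_varIdeal_iff.mp h
  simp

theorem map_mem_varIdeal (σ : MvPowerSeries (Fin 2) K →ₐ[K] MvPowerSeries (Fin 2) K)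
    (h : ∀ i, σ (X i) ∈ varIdeal K) {P : MvPowerSeries (Fin 2) K} (hP : P ∈ varIdeal K) :
    σ P ∈ varIdeal K := by
  obtain ⟨a, b, rfl⟩ := mem_varIdeal_iff.mp hP
  rw [map_add, map_mul, map_mul]
  exact add_mem (Ideal.mul_mem_right _ _ (h 0)) (Ideal.mul_mem_right _ _ (h 1))

theorem map_mem_varIdeal_sq (σ : MvPowerSeries (Fin 2) K →ₐ[K] MvPowerSeries (Fin 2) K)
    (h : ∀ i, σ (X i) ∈ varIdeal K) {P : MvPowerSeries (Fin 2) K} (hP : P ∈ varIdeal K ^ 2) :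
    σ P ∈ varIdeal K ^ 2 := by
  rw [pow_two] at hP ⊢
  refine Submodule.mul_induction_on hP (fun m hm n hn => ?_) (fun x y hx hy => ?_)
  · rw [map_mul]
    exact Ideal.mul_mem_mul (map_mem_varIdeal σ h hm) (map_mem_varIdeal σ h hn)
  · rw [map_add]; exact add_mem hx hy

theorem bijective_of_X_sub_mem (ρ : MvPowerSeries (Fin 2) K →ₐ[K] MvPowerSeries (Fin 2) K)
    (h : ∀ i, ρ (X i) - X i ∈ varIdeal K ^ 2) : Function.Bijective ρ := by
  have : IsAdicComplete (varIdeal K) (MvPowerSeries (Fin 2) K) := by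
    unfold varIdeal; infer_instance
  have hX : ∀ i, ρ (X i) ∈ varIdeal K := fun i => by
    have := add_mem (Ideal.pow_le_self two_ne_zero (h i)) (X_mem_varIdeal (K := K) i)
    simpa using this
  have h₀ : ∀ P, ρ P - P ∈ varIdeal K := by
    intro P
    obtain ⟨c, P₀, P₁, rfl⟩ := exists_eq_C_add P
    have e : ρ (algebraMap K _ c + X 0 * P₀ + X 1 * P₁) - (algebraMap K _ c + X 0 * P₀ + X 1 * P₁)
        = ρ (X 0) * ρ P₀ + ρ (X 1) * ρ P₁ - (X 0 * P₀ + X 1 * P₁) := by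
      simp only [map_add, map_mul, AlgHom.commutes]; ring
    rw [e]
    exact sub_mem (add_mem (Ideal.mul_mem_right _ _ (hX 0)) (Ideal.mul_mem_right _ _ (hX 1)))
      (mem_varIdeal_iff.mpr ⟨_, _, rfl⟩)
  refine RingHom.bijective_of_sub_mem_sq (varIdeal K) (ρ : _ →+* _) h₀ fun P hP => ?_
  obtain ⟨P₀, P₁, rfl⟩ := mem_varIdeal_iff.mp hP
  have e : ρ (X 0 * P₀ + X 1 * P₁) - (X 0 * P₀ + X 1 * P₁)
      = ((ρ (X 0) - X 0) * ρ P₀ + (ρ (X 1) - X 1) * ρ P₁)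
        + (X 0 * (ρ P₀ - P₀) + X 1 * (ρ P₁ - P₁)) := by
    simp only [map_add, map_mul]; ring
  change ρ (X 0 * P₀ + X 1 * P₁) - (X 0 * P₀ + X 1 * P₁) ∈ _
  rw [e]
  refine add_mem (add_mem (Ideal.mul_mem_right _ _ (h 0)) (Ideal.mul_mem_right _ _ (h 1))) ?_
  rw [pow_two]
  exact add_mem (Ideal.mul_mem_mul (X_mem_varIdeal 0) (h₀ P₀))
    (Ideal.mul_mem_mul (X_mem_varIdeal 1) (h₀ P₁))

/-- The formal inverse function theorem in two variables. -/
theorem bijective_of_det_ne_zero (σ : MvPowerSeries (Fin 2) K →ₐ[K] MvPowerSeries (Fin 2) K)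
    (α β γ δ : K) (h0 : σ (X 0) - (α • X 0 + β • X 1) ∈ varIdeal K ^ 2)
    (h1 : σ (X 1) - (γ • X 0 + δ • X 1) ∈ varIdeal K ^ 2) (hd : α * δ - β * γ ≠ 0) :
    Function.Bijective σ := by
  have hsm : ∀ (J : Ideal (MvPowerSeries (Fin 2) K)) (c : K) (P), P ∈ J → c • P ∈ J := by
    intro J c P hP
    rw [Algebra.smul_def]; exact Ideal.mul_mem_left _ _ hP
  set d := α * δ - β * γ with hdd
  -- The inverse of the linear part. Composed with `σ` on either side it is the identity modulo the
  -- square of the ideal, so both composites are bijective.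
  let T : Fin 2 → MvPowerSeries (Fin 2) K :=
    ![d⁻¹ • (δ • X 0 - β • X 1), d⁻¹ • (α • X 1 - γ • X 0)]
  have hTm : ∀ i, T i ∈ varIdeal K := by
    intro i
    fin_cases i
    · exact hsm _ _ _ (sub_mem (hsm _ _ _ (X_mem_varIdeal 0)) (hsm _ _ _ (X_mem_varIdeal 1)))
    · exact hsm _ _ _ (sub_mem (hsm _ _ _ (X_mem_varIdeal 1)) (hsm _ _ _ (X_mem_varIdeal 0)))
  have hT : HasSubst T := hasSubst_of_constantCoeff_zero fun i =>
    constantCoeff_eq_zero_of_mem_varIdeal (hTm i)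
  let τ : MvPowerSeries (Fin 2) K →ₐ[K] MvPowerSeries (Fin 2) K := substAlgHom hT
  have hτ : ∀ i, τ (X i) = T i := fun i => by
    rw [substAlgHom_apply, subst_X hT]
  have hτ0 : τ (X 0) = d⁻¹ • (δ • X 0 - β • X 1) := hτ 0
  have hτ1 : τ (X 1) = d⁻¹ • (α • X 1 - γ • X 0) := hτ 1
  have hτm : ∀ i, τ (X i) ∈ varIdeal K := fun i => by rw [hτ]; exact hTm i
  obtain ⟨q0, hq0⟩ : ∃ q, q = σ (X 0) - (α • X 0 + β • X 1) := ⟨_, rfl⟩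
  obtain ⟨q1, hq1⟩ : ∃ q, q = σ (X 1) - (γ • X 0 + δ • X 1) := ⟨_, rfl⟩
  rw [← hq0] at h0
  rw [← hq1] at h1
  have hs0 : σ (X 0) = α • X 0 + β • X 1 + q0 := by rw [hq0]; ring
  have hs1 : σ (X 1) = γ • X 0 + δ • X 1 + q1 := by rw [hq1]; ring
  have b1 : Function.Bijective (σ.comp τ) := by
    refine bijective_of_X_sub_mem _ fun i => ?_
    fin_cases i
    · have e : σ (τ (X 0)) - X 0 = d⁻¹ • (δ • q0 - β • q1) := by
        rw [hτ0, map_smul, map_sub, map_smul, map_smul, hs0, hs1]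
        match_scalars <;> field_simp <;> rw [hdd] <;> ring
      change σ (τ (X 0)) - X 0 ∈ _
      rw [e]
      exact hsm _ _ _ (sub_mem (hsm _ _ _ h0) (hsm _ _ _ h1))
    · have e : σ (τ (X 1)) - X 1 = d⁻¹ • (α • q1 - γ • q0) := by
        rw [hτ1, map_smul, map_sub, map_smul, map_smul, hs0, hs1]
        match_scalars <;> field_simp <;> rw [hdd] <;> ring
      change σ (τ (X 1)) - X 1 ∈ _
      rw [e]
      exact hsm _ _ _ (sub_mem (hsm _ _ _ h1) (hsm _ _ _ h0))
  have b2 : Function.Bijective (τ.comp σ) := by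
    refine bijective_of_X_sub_mem _ fun i => ?_
    fin_cases i
    · have e : τ (σ (X 0)) - X 0 = τ q0 := by
        rw [hs0, map_add, map_add, map_smul, map_smul, hτ0, hτ1]
        match_scalars <;> field_simp <;> rw [hdd] <;> ring
      change τ (σ (X 0)) - X 0 ∈ _
      rw [e]
      exact map_mem_varIdeal_sq τ hτm h0
    · have e : τ (σ (X 1)) - X 1 = τ q1 := by
        rw [hs1, map_add, map_add, map_smul, map_smul, hτ0, hτ1]
        match_scalars <;> field_simp <;> rw [hdd] <;> ring
      change τ (σ (X 1)) - X 1 ∈ _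
      rw [e]
      exact map_mem_varIdeal_sq τ hτm h1
  exact ⟨Function.Injective.of_comp (f := τ) b2.1, Function.Surjective.of_comp (g := τ) b1.2⟩

/-- Writing `P = c + xP₀ + yP₁` gains one power of `t` per step. No continuity is needed, so an
algebra morphism is determined by its values on the variables. -/
theorem X_pow_dvd_map_sub (f g : MvPowerSeries (Fin 2) K →ₐ[K] PowerSeries K) (n : ℕ)
    (hg : ∀ i, PowerSeries.X ∣ g (X i)) (hfg : ∀ i, PowerSeries.X ^ n ∣ f (X i) - g (X i))
    (P : MvPowerSeries (Fin 2) K) : PowerSeries.X ^ n ∣ f P - g P := by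
  have key : ∀ j ≤ n, ∀ P, PowerSeries.X ^ j ∣ f P - g P := by
    intro j
    induction j with
    | zero => intro _ P; simp
    | succ j ih =>
      intro hj P
      obtain ⟨c, P₀, P₁, rfl⟩ := exists_eq_C_add P
      have e : f (algebraMap K _ c + X 0 * P₀ + X 1 * P₁)
          - g (algebraMap K _ c + X 0 * P₀ + X 1 * P₁)
          = ((f (X 0) - g (X 0)) * f P₀ + g (X 0) * (f P₀ - g P₀))
          + ((f (X 1) - g (X 1)) * f P₁ + g (X 1) * (f P₁ - g P₁)) := by
        simp only [map_add, map_mul, AlgHom.commutes]; ring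
      have t : ∀ i Q, PowerSeries.X ^ (j + 1) ∣
          (f (X i) - g (X i)) * f Q + g (X i) * (f Q - g Q) := by
        intro i Q
        refine dvd_add (((pow_dvd_pow _ hj).trans (hfg i)).mul_right _) ?_
        rw [pow_succ']
        exact mul_dvd_mul (hg i) (ih (by omega) Q)
      rw [e]
      exact dvd_add (t 0 _) (t 1 _)
  exact key n le_rfl P

end MvPowerSeries

/-! ### Orders under automorphisms of `K[[t]]` -/

namespace PowerSeries

variable {K : Type*} [Field K]

theorem eq_zero_of_X_pow_dvd {f : PowerSeries K} (h : ∀ n, X ^ n ∣ f) : f = 0 := by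
  ext n
  simpa using X_pow_dvd_iff.mp (h (n + 1)) n (Nat.lt_succ_self n)

theorem order_algEquiv (r : PowerSeries K ≃ₐ[K] PowerSeries K) (f : PowerSeries K) :
    (r f).order = f.order := by
  have hp : Prime (r X) := (MulEquiv.prime_iff r.toMulEquiv).mpr X_prime
  have ha : Associated (X : PowerSeries K) (r X) :=
    IsDiscreteValuationRing.associated_of_irreducible _ X_prime.irreducible hp.irreducible
  rw [order_eq_emultiplicity_X, order_eq_emultiplicity_X,
    emultiplicity_eq_of_associated_left ha.symm, emultiplicity_map_eq]

theorem X_pow_dvd_iff_le_order {f : PowerSeries K} {n : ℕ} : X ^ n ∣ f ↔ (n : ℕ∞) ≤ f.order := by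
  rw [X_pow_dvd_iff]
  exact ⟨nat_le_order f n, fun h m hm =>
    coeff_of_lt_order m (lt_of_lt_of_le (by exact_mod_cast hm) h)⟩

theorem X_pow_dvd_algEquiv (r : PowerSeries K ≃ₐ[K] PowerSeries K) {f : PowerSeries K} {n : ℕ} :
    X ^ n ∣ r f ↔ X ^ n ∣ f := by
  rw [X_pow_dvd_iff_le_order, order_algEquiv, X_pow_dvd_iff_le_order]

end PowerSeries

/-! ### Left-right equivalence and its invariants -/

namespace PlaneParam

variable {K : Type*} [Field K]

open MvPowerSeries (varIdeal inX)

theorem hom_X_zero (ψ : PlaneParam K) : ψ.hom (MvPowerSeries.X 0) = ψ.x := by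
  rw [hom, MvPowerSeries.substAlgHom_apply, MvPowerSeries.subst_X ψ.hasSubst]; rfl

theorem hom_X_one (ψ : PlaneParam K) : ψ.hom (MvPowerSeries.X 1) = ψ.y := by
  rw [hom, MvPowerSeries.substAlgHom_apply, MvPowerSeries.subst_X ψ.hasSubst]; rfl

theorem X_dvd_hom_X (ψ : PlaneParam K) (i : Fin 2) :
    PowerSeries.X ∣ ψ.hom (MvPowerSeries.X i) := by
  rw [PowerSeries.X_dvd_iff]
  fin_cases i
  · exact ψ.hom_X_zero ▸ ψ.constantCoeff_x
  · exact ψ.hom_X_one ▸ ψ.constantCoeff_y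

theorem eq_hom (ψ : PlaneParam K) (f : MvPowerSeries (Fin 2) K →ₐ[K] PowerSeries K)
    (h0 : f (MvPowerSeries.X 0) = ψ.x) (h1 : f (MvPowerSeries.X 1) = ψ.y) : ψ.hom = f := by
  refine AlgHom.ext fun P => sub_eq_zero.mp (PowerSeries.eq_zero_of_X_pow_dvd fun n => ?_)
  refine (dvd_sub_comm.mp ?_)
  refine MvPowerSeries.X_pow_dvd_map_sub f ψ.hom n ψ.X_dvd_hom_X (fun i => ?_) P
  fin_cases i
  · exact (sub_eq_zero.mpr (h0.trans ψ.hom_X_zero.symm)) ▸ dvd_zero _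
  · exact (sub_eq_zero.mpr (h1.trans ψ.hom_X_one.symm)) ▸ dvd_zero _

theorem AEquiv.trans {ψ φ χ : PlaneParam K} (h₁ : ψ.AEquiv φ) (h₂ : φ.AEquiv χ) :
    ψ.AEquiv χ := by
  obtain ⟨l, r, h⟩ := h₁
  obtain ⟨l', r', h'⟩ := h₂
  refine ⟨l.trans l', r.trans r', ?_⟩
  rw [h', h]
  rfl

theorem AEquiv.trans_to {ψ φ : PlaneParam K} (h₁ : ψ.AEquiv φ) {u v : PowerSeries K}
    (h₂ : φ.AEquivTo u v) : ψ.AEquivTo u v := by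
  obtain ⟨χ, h, h'⟩ := h₂
  exact ⟨χ, h₁.trans h, h'⟩

theorem AEquiv.exists_mem_ring_iff {ψ φ : PlaneParam K} (h : ψ.AEquiv φ) :
    ∃ r : PowerSeries K ≃ₐ[K] PowerSeries K, ∀ f, r f ∈ φ.ring ↔ f ∈ ψ.ring := by
  obtain ⟨l, r, h⟩ := h
  refine ⟨r, fun f => ⟨?_, ?_⟩⟩
  · rintro ⟨P, hP⟩
    refine ⟨l.symm P, r.injective ?_⟩
    rw [← hP]
    exact (DFunLike.congr_fun h P).symm
  · rintro ⟨P, hP⟩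
    refine ⟨l P, ?_⟩
    change φ.hom (l P) = r f
    rw [h, ← hP]
    change r (ψ.hom (l.symm (l P))) = r (ψ.hom P)
    rw [l.symm_apply_apply]

theorem AEquiv.semigroup_eq {ψ φ : PlaneParam K} (h : ψ.AEquiv φ) :
    φ.semigroup = ψ.semigroup := by
  obtain ⟨r, hr⟩ := h.exists_mem_ring_iff
  ext n
  constructor
  · rintro ⟨f, hf, hn⟩
    refine ⟨r.symm f, (hr _).mp (by simpa using hf), ?_⟩
    rw [← PowerSeries.order_algEquiv r]; simpa using hn
  · rintro ⟨f, hf, hn⟩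
    exact ⟨r f, (hr f).mpr hf, by rw [PowerSeries.order_algEquiv, hn]⟩

theorem AEquiv.conductor_eq {ψ φ : PlaneParam K} (h : ψ.AEquiv φ) :
    φ.conductor = ψ.conductor := by
  rw [conductor, conductor, h.semigroup_eq]

/-- The parametrization `r ∘ ψ`. -/
noncomputable def reparam (ψ : PlaneParam K) (r : PowerSeries K ≃ₐ[K] PowerSeries K) :
    PlaneParam K where
  x := r ψ.x
  y := r ψ.y
  constantCoeff_x := by
    have := (PowerSeries.X_pow_dvd_algEquiv r (f := ψ.x) (n := 1))
    simpa [PowerSeries.X_dvd_iff, ψ.constantCoeff_x] using this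
  constantCoeff_y := by
    have := (PowerSeries.X_pow_dvd_algEquiv r (f := ψ.y) (n := 1))
    simpa [PowerSeries.X_dvd_iff, ψ.constantCoeff_y] using this
  ne_zero := ψ.ne_zero.imp (by simp) (by simp)

theorem reparam_aequiv (ψ : PlaneParam K) (r : PowerSeries K ≃ₐ[K] PowerSeries K) :
    ψ.AEquiv (ψ.reparam r) := by
  refine ⟨AlgEquiv.refl, r, eq_hom _ _ ?_ ?_⟩
  · exact congrArg r ψ.hom_X_zero
  · exact congrArg r ψ.hom_X_one

/-- The substitution `x ↦ U`, `y ↦ V` has an invertible linear part, hence is an automorphism; it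
serves as `l⁻¹`. -/
theorem aequiv_of_det_ne_zero (ψ φ : PlaneParam K) (U V : MvPowerSeries (Fin 2) K)
    (hU : ψ.hom U = φ.x) (hV : ψ.hom V = φ.y) (α β γ δ : K)
    (h0 : U - (α • MvPowerSeries.X 0 + β • MvPowerSeries.X 1) ∈ varIdeal K ^ 2)
    (h1 : V - (γ • MvPowerSeries.X 0 + δ • MvPowerSeries.X 1) ∈ varIdeal K ^ 2)
    (hd : α * δ - β * γ ≠ 0) : ψ.AEquiv φ := by
  have hlin : ∀ (W : MvPowerSeries (Fin 2) K) (s t : K),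
      W - (s • MvPowerSeries.X 0 + t • MvPowerSeries.X 1) ∈ varIdeal K ^ 2 →
        MvPowerSeries.constantCoeff W = 0 := by
    intro W s t h
    apply MvPowerSeries.constantCoeff_eq_zero_of_mem_varIdeal
    have h' := Ideal.pow_le_self two_ne_zero h
    have h'' : s • MvPowerSeries.X 0 + t • MvPowerSeries.X 1 ∈ varIdeal K := by
      rw [Algebra.smul_def, Algebra.smul_def]
      exact add_mem (Ideal.mul_mem_left _ _ (MvPowerSeries.X_mem_varIdeal 0))
        (Ideal.mul_mem_left _ _ (MvPowerSeries.X_mem_varIdeal 1))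
    simpa using add_mem h' h''
  have hs : MvPowerSeries.HasSubst ![U, V] := by
    apply MvPowerSeries.hasSubst_of_constantCoeff_zero
    intro i
    fin_cases i
    · exact hlin _ _ _ h0
    · exact hlin _ _ _ h1
  let σ : MvPowerSeries (Fin 2) K →ₐ[K] MvPowerSeries (Fin 2) K := MvPowerSeries.substAlgHom hs
  have hσ0 : σ (MvPowerSeries.X 0) = U := by
    rw [MvPowerSeries.substAlgHom_apply, MvPowerSeries.subst_X hs]; rfl
  have hσ1 : σ (MvPowerSeries.X 1) = V := by
    rw [MvPowerSeries.substAlgHom_apply, MvPowerSeries.subst_X hs]; rfl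
  have hb : Function.Bijective σ := MvPowerSeries.bijective_of_det_ne_zero σ α β γ δ
    (by rwa [hσ0]) (by rwa [hσ1]) hd
  refine ⟨(AlgEquiv.ofBijective σ hb).symm, AlgEquiv.refl, eq_hom _ _ ?_ ?_⟩
  · change ψ.hom (σ (MvPowerSeries.X 0)) = _
    rw [hσ0, hU]
  · change ψ.hom (σ (MvPowerSeries.X 1)) = _
    rw [hσ1, hV]

end PlaneParam

/-! ### Leading terms and adapted parametrizations -/

namespace PowerSeries

variable {K : Type*} [Field K]

theorem order_eq_natCast_iff {f : PowerSeries K} {n : ℕ} :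
    f.order = n ↔ X ^ n ∣ f ∧ coeff n f ≠ 0 := by
  rw [order_eq_nat, X_pow_dvd_iff, and_comm]

theorem X_pow_succ_dvd_iff {f : PowerSeries K} {n : ℕ} :
    X ^ (n + 1) ∣ f ↔ X ^ n ∣ f ∧ coeff n f = 0 := by
  simp only [X_pow_dvd_iff]
  refine ⟨fun h => ⟨fun m hm => h m (by omega), h n (by omega)⟩, fun h m hm => ?_⟩
  rcases Nat.lt_succ_iff_lt_or_eq.mp hm with h' | rfl
  exacts [h.1 m h', h.2]

theorem X_pow_succ_dvd_sub_smul {f g : PowerSeries K} {n : ℕ} (hf : X ^ n ∣ f)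
    (hg : X ^ n ∣ g) (hg' : coeff n g ≠ 0) :
    X ^ (n + 1) ∣ f - (coeff n f / coeff n g) • g := by
  rw [X_pow_succ_dvd_iff]
  refine ⟨dvd_sub hf (hg.trans (Dvd.intro_left (C (coeff n f / coeff n g))
    (smul_eq_C_mul _ _).symm)), ?_⟩
  simp [div_mul_cancel₀ _ hg']

theorem dvd_smul_right_of_dvd {d f : PowerSeries K} (c : K) (h : d ∣ f) : d ∣ c • f := by
  rw [smul_eq_C_mul]; exact h.mul_left _

theorem order_eq_of_dvd_sub {f g : PowerSeries K} {n m : ℕ} (h : X ^ m ∣ f - g) (hnm : n < m)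
    (hf : f.order = n) : g.order = n := by
  rw [order_eq_natCast_iff] at hf ⊢
  have h' := X_pow_dvd_iff.mp h n hnm
  rw [map_sub, sub_eq_zero] at h'
  refine ⟨?_, h' ▸ hf.2⟩
  have := dvd_sub hf.1 ((pow_dvd_pow X hnm.le).trans h)
  simpa using this

theorem exists_eq_linear_add (F : PowerSeries K) :
    ∃ G, F = algebraMap K _ (constantCoeff F) + coeff 1 F • X + X ^ 2 * G := by
  have : X ^ 2 ∣ F - (algebraMap K _ (constantCoeff F) + coeff 1 F • X) := by
    rw [X_pow_dvd_iff]
    intro m hm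
    interval_cases m
    · simp
    · simp
  obtain ⟨G, hG⟩ := this
  exact ⟨G, by rw [← hG]; ring⟩

theorem exists_unit_mul_of_ne_zero {z : PowerSeries K} (hz : z ≠ 0) :
    ∃ (o : ℕ) (u : (PowerSeries K)ˣ), z = X ^ o * (u : PowerSeries K) := by
  refine ⟨z.order.toNat, IsUnit.unit (a := z.divXPowOrder) ?_, ?_⟩
  · rw [isUnit_iff_constantCoeff, constantCoeff_divXPowOrder]
    exact (coeff_order hz).isUnit
  · exact X_pow_order_mul_divXPowOrder.symm

end PowerSeries

namespace PlaneParam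

variable {K : Type*} [Field K]

open MvPowerSeries (varIdeal inX)
open PowerSeries

/-- The morphism `K[[x]] → K[[t]]`, `F ↦ F(x(t))`. -/
noncomputable def homX (ψ : PlaneParam K) : PowerSeries K →ₐ[K] PowerSeries K :=
  ψ.hom.comp (inX K)

theorem homX_X (ψ : PlaneParam K) : ψ.homX X = ψ.x :=
  (congrArg ψ.hom MvPowerSeries.inX_X).trans ψ.hom_X_zero

theorem homX_mem_ring (ψ : PlaneParam K) (F : PowerSeries K) : ψ.homX F ∈ ψ.ring :=
  ⟨inX K F, rfl⟩

theorem x_mem_ring (ψ : PlaneParam K) : ψ.x ∈ ψ.ring := ⟨_, ψ.hom_X_zero⟩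

theorem y_mem_ring (ψ : PlaneParam K) : ψ.y ∈ ψ.ring := ⟨_, ψ.hom_X_one⟩

theorem hom_inX_add (ψ : PlaneParam K) (F : PowerSeries K) (Q : MvPowerSeries (Fin 2) K) :
    ψ.hom (inX K F + MvPowerSeries.X 1 * Q) = ψ.homX F + ψ.y * ψ.hom Q := by
  rw [map_add, map_mul, hom_X_one]; rfl

theorem constantCoeff_hom (ψ : PlaneParam K) (P : MvPowerSeries (Fin 2) K) :
    constantCoeff (ψ.hom P) = MvPowerSeries.constantCoeff P := by
  obtain ⟨c, P₀, P₁, rfl⟩ := MvPowerSeries.exists_eq_C_add P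
  simp only [map_add, map_mul, AlgHom.commutes, hom_X_zero, hom_X_one, ψ.constantCoeff_x,
    ψ.constantCoeff_y, MvPowerSeries.constantCoeff_X, zero_mul, add_zero]
  simp [MvPowerSeries.algebraMap_apply]

theorem constantCoeff_homX (ψ : PlaneParam K) (F : PowerSeries K) :
    constantCoeff (ψ.homX F) = constantCoeff F := by
  obtain ⟨G, hG⟩ := exists_eq_linear_add F
  conv_lhs => rw [hG]
  rw [map_add ψ.homX, map_add ψ.homX, AlgHom.commutes, map_mul, map_smul, map_pow, homX_X]
  simp [ψ.constantCoeff_x, smul_eq_C_mul]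

/-- `F` is `X^k` times a unit, so `F(x(t))` has order `ak`. -/
theorem dvd_of_order_homX (ψ : PlaneParam K) {a n : ℕ} (ha : ψ.x.order = a) {F : PowerSeries K}
    (h : (ψ.homX F).order = n) : a ∣ n := by
  have hF : F ≠ 0 := by
    rintro rfl
    simp at h
  obtain ⟨k, u, rfl⟩ := exists_unit_mul_of_ne_zero hF
  rw [map_mul, map_pow, homX_X, order_mul, order_pow, ha,
    order_zero_of_unit (u.isUnit.map ψ.homX), add_zero, nsmul_eq_mul] at h
  exact ⟨k, by rw [mul_comm]; exact_mod_cast h.symm⟩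

theorem sub_linear_mem_sq (F : PowerSeries K) (hF : constantCoeff F = 0)
    (Q : MvPowerSeries (Fin 2) K) :
    inX K F + MvPowerSeries.X 1 * Q -
      (coeff 1 F • MvPowerSeries.X 0 + MvPowerSeries.constantCoeff Q • MvPowerSeries.X 1)
        ∈ varIdeal K ^ 2 := by
  obtain ⟨G, hG⟩ := exists_eq_linear_add F
  obtain ⟨c, Q₀, Q₁, rfl⟩ := MvPowerSeries.exists_eq_C_add Q
  have hc : MvPowerSeries.constantCoeff (σ := Fin 2)
      (algebraMap K _ c + MvPowerSeries.X 0 * Q₀ + MvPowerSeries.X 1 * Q₁) = c := by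
    simp [MvPowerSeries.algebraMap_apply]
  have e : inX K F = coeff 1 F • MvPowerSeries.X 0 + MvPowerSeries.X 0 ^ 2 * inX K G := by
    conv_lhs => rw [hG, hF]
    simp
  rw [hc, e, Algebra.smul_def c]
  have e' : coeff 1 F • MvPowerSeries.X 0 + MvPowerSeries.X 0 ^ 2 * inX K G +
      MvPowerSeries.X 1 * (algebraMap K _ c + MvPowerSeries.X 0 * Q₀ + MvPowerSeries.X 1 * Q₁) -
      (coeff 1 F • MvPowerSeries.X 0 +
        algebraMap K (MvPowerSeries (Fin 2) K) c * MvPowerSeries.X 1)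
      = MvPowerSeries.X 0 * MvPowerSeries.X 0 * inX K G +
        (MvPowerSeries.X 1 * MvPowerSeries.X 0 * Q₀ +
        MvPowerSeries.X 1 * MvPowerSeries.X 1 * Q₁) := by ring
  rw [e', pow_two]
  have m := fun i j => Ideal.mul_mem_mul (MvPowerSeries.X_mem_varIdeal (K := K) i)
    (MvPowerSeries.X_mem_varIdeal (K := K) j)
  exact add_mem (Ideal.mul_mem_right _ _ (m 0 0))
    (add_mem (Ideal.mul_mem_right _ _ (m 1 0)) (Ideal.mul_mem_right _ _ (m 1 1)))

/-- The components have orders `a` and `b`, the multiplicity and the least value that is not a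
multiple of it. -/
structure IsAdapted (ψ : PlaneParam K) (a b : ℕ) : Prop where
  order_x : ψ.x.order = a
  order_y : ψ.y.order = b
  pos : 0 < a
  lt : a < b
  not_dvd : ¬ a ∣ b

namespace IsAdapted

variable {ψ : PlaneParam K} {a b : ℕ}

theorem X_pow_dvd_x (h : ψ.IsAdapted a b) : X ^ a ∣ ψ.x :=
  (order_eq_natCast_iff.mp h.order_x).1

theorem X_pow_dvd_y (h : ψ.IsAdapted a b) : X ^ b ∣ ψ.y :=
  (order_eq_natCast_iff.mp h.order_y).1

theorem homX_congr (h : ψ.IsAdapted a b) {F : PowerSeries K} (hF : constantCoeff F = 0) :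
    X ^ (a + 1) ∣ ψ.homX F - coeff 1 F • ψ.x := by
  obtain ⟨G, hG⟩ := exists_eq_linear_add F
  rw [hF, map_zero, zero_add] at hG
  have e : ψ.homX F - coeff 1 F • ψ.x = ψ.x ^ 2 * ψ.homX G := by
    generalize coeff 1 F = c at hG ⊢
    rw [hG, map_add, map_smul, map_mul, map_pow, homX_X]
    ring
  rw [e]
  have e' : X ^ (a * 2) ∣ ψ.x ^ 2 := by
    rw [pow_mul]; exact pow_dvd_pow_of_dvd h.X_pow_dvd_x 2
  refine ((pow_dvd_pow X ?_).trans e').mul_right _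
  have := h.pos
  omega

theorem hom_congr (h : ψ.IsAdapted a b) {F : PowerSeries K} (hF : constantCoeff F = 0)
    (Q : MvPowerSeries (Fin 2) K) :
    X ^ (a + 1) ∣ ψ.hom (inX K F + MvPowerSeries.X 1 * Q) - coeff 1 F • ψ.x := by
  rw [hom_inX_add, add_sub_right_comm]
  exact dvd_add (h.homX_congr hF) (((pow_dvd_pow X h.lt).trans h.X_pow_dvd_y).mul_right _)

theorem constantCoeff_eq_zero {F : PowerSeries K} {Q : MvPowerSeries (Fin 2) K} {n : ℕ}
    (hn : n ≠ 0) (h : (ψ.hom (inX K F + MvPowerSeries.X 1 * Q)).order = n) :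
    constantCoeff F = 0 := by
  rw [hom_inX_add, order_eq_natCast_iff] at h
  have := X_pow_dvd_iff.mp h.1 0 (Nat.pos_of_ne_zero hn)
  simpa [ψ.constantCoeff_y, constantCoeff_homX] using this

theorem coeff_one_ne_zero (h : ψ.IsAdapted a b) {F : PowerSeries K}
    {Q : MvPowerSeries (Fin 2) K}
    (ho : (ψ.hom (inX K F + MvPowerSeries.X 1 * Q)).order = a) : coeff 1 F ≠ 0 := by
  intro h0
  have := h.hom_congr (constantCoeff_eq_zero h.pos.ne' ho) Q
  rw [h0, zero_smul, sub_zero, X_pow_succ_dvd_iff] at this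
  exact (order_eq_natCast_iff.mp ho).2 this.2

theorem coeff_one_eq_zero (h : ψ.IsAdapted a b) {F : PowerSeries K}
    {Q : MvPowerSeries (Fin 2) K}
    (ho : (ψ.hom (inX K F + MvPowerSeries.X 1 * Q)).order = b) : coeff 1 F = 0 := by
  have := h.hom_congr (constantCoeff_eq_zero (h.pos.trans h.lt).ne' ho) Q
  have h' := X_pow_dvd_iff.mp this a (Nat.lt_succ_self a)
  rw [map_sub, X_pow_dvd_iff.mp (order_eq_natCast_iff.mp ho).1 a h.lt, zero_sub, neg_eq_zero,
    coeff_smul] at h'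
  exact (mul_eq_zero.mp h').resolve_right (order_eq_natCast_iff.mp h.order_x).2

/-- If `Q` had no constant term, `yQ` would have order above `b`, and `F(x)` would have order `b`,
which is not a multiple of `a`. -/
theorem constantCoeff_ne_zero (h : ψ.IsAdapted a b) {F : PowerSeries K}
    {Q : MvPowerSeries (Fin 2) K}
    (ho : (ψ.hom (inX K F + MvPowerSeries.X 1 * Q)).order = b) :
    MvPowerSeries.constantCoeff Q ≠ 0 := by
  intro h0
  refine h.not_dvd (ψ.dvd_of_order_homX h.order_x (F := F) ?_)
  refine order_eq_of_dvd_sub (m := b + 1) ?_ (Nat.lt_succ_self b) ho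
  rw [hom_inX_add, add_sub_cancel_left, pow_succ]
  refine mul_dvd_mul h.X_pow_dvd_y ?_
  rw [X_dvd_iff, constantCoeff_hom, h0]

/-- The two elements have preimages in `K[[x,y]]` with triangular linear part: order `a` forces a
nonzero `x`-coefficient, order `b` forces a zero `x`-coefficient and a nonzero `y`-coefficient. -/
theorem aequivTo (h : ψ.IsAdapted a b) {u v : PowerSeries K} (hu : u ∈ ψ.ring)
    (hv : v ∈ ψ.ring) (hua : u.order = a) (hvb : v.order = b) : ψ.AEquivTo u v := by
  obtain ⟨U, hU⟩ := hu
  obtain ⟨V, hV⟩ := hv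
  change ψ.hom U = u at hU
  change ψ.hom V = v at hV
  obtain ⟨F, Q, rfl⟩ := MvPowerSeries.exists_eq_inX_add U
  obtain ⟨G, R, rfl⟩ := MvPowerSeries.exists_eq_inX_add V
  have ha := h.pos.ne'
  have hb := (h.pos.trans h.lt).ne'
  have hua' := hua
  have hvb' := hvb
  rw [← hU] at hua'
  rw [← hV] at hvb'
  have hF := constantCoeff_eq_zero ha hua'
  have hG := constantCoeff_eq_zero hb hvb'
  have hcc : ∀ {f : PowerSeries K} {n : ℕ}, n ≠ 0 → f.order = n → constantCoeff f = 0 := by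
    intro f n hn hf
    simpa using X_pow_dvd_iff.mp (order_eq_natCast_iff.mp hf).1 0 (Nat.pos_of_ne_zero hn)
  let φ : PlaneParam K :=
    { x := u
      y := v
      constantCoeff_x := hcc ha hua
      constantCoeff_y := hcc hb hvb
      ne_zero := Or.inl (by rintro rfl; simp at hua) }
  refine ⟨φ, aequiv_of_det_ne_zero ψ φ _ _ hU hV _ _ _ _ (sub_linear_mem_sq F hF Q)
    (sub_linear_mem_sq G hG R) ?_, rfl, rfl⟩
  rw [h.coeff_one_eq_zero hvb', mul_zero, sub_zero]
  exact mul_ne_zero (h.coeff_one_ne_zero hua') (h.constantCoeff_ne_zero hvb')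

theorem isLeast_mult (h : ψ.IsAdapted a b) : IsLeast {n | n ∈ ψ.semigroup ∧ n ≠ 0} a := by
  refine ⟨⟨⟨ψ.x, ψ.x_mem_ring, h.order_x⟩, h.pos.ne'⟩, ?_⟩
  rintro n ⟨⟨f, ⟨P, hP⟩, hn⟩, hn0⟩
  change ψ.hom P = f at hP
  obtain ⟨F, Q, rfl⟩ := MvPowerSeries.exists_eq_inX_add P
  subst hP
  by_contra hlt
  have := h.hom_congr (constantCoeff_eq_zero hn0 hn) Q
  have h' := X_pow_dvd_iff.mp this n (by omega)
  rw [map_sub, coeff_smul, X_pow_dvd_iff.mp h.X_pow_dvd_x n (by omega), smul_zero, sub_zero] at h'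
  exact (order_eq_natCast_iff.mp hn).2 h'

/-- Below order `b` only `F(x)` contributes to `F(x) + yQ`, and its order is a multiple of `a`. -/
theorem isLeast_not_dvd (h : ψ.IsAdapted a b) :
    IsLeast {n | n ∈ ψ.semigroup ∧ ¬ a ∣ n} b := by
  refine ⟨⟨⟨ψ.y, ψ.y_mem_ring, h.order_y⟩, h.not_dvd⟩, ?_⟩
  rintro n ⟨⟨f, ⟨P, hP⟩, hn⟩, hn0⟩
  change ψ.hom P = f at hP
  obtain ⟨F, Q, rfl⟩ := MvPowerSeries.exists_eq_inX_add P
  subst hP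
  by_contra hlt
  refine hn0 (ψ.dvd_of_order_homX h.order_x (F := F) ?_)
  refine order_eq_of_dvd_sub (m := b) ?_ (not_le.mp hlt) hn
  rw [hom_inX_add, add_sub_cancel_left]
  exact h.X_pow_dvd_y.mul_right _

theorem reparam (h : ψ.IsAdapted a b) (r : PowerSeries K ≃ₐ[K] PowerSeries K) :
    (ψ.reparam r).IsAdapted a b :=
  { h with
    order_x := (order_algEquiv r _).trans h.order_x
    order_y := (order_algEquiv r _).trans h.order_y }

end IsAdapted

/-! ### The conductor and the existence of adapted parametrizations -/

/-- The ring of the parametrization contains a power of the maximal ideal of `K[[t]]`. -/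
def HasConductor (ψ : PlaneParam K) : Prop :=
  ∃ N : ℕ, ∀ f : PowerSeries K, X ^ N ∣ f → f ∈ ψ.ring

theorem AEquiv.hasConductor {ψ φ : PlaneParam K} (h : ψ.AEquiv φ) (hN : ψ.HasConductor) :
    φ.HasConductor := by
  obtain ⟨r, hr⟩ := h.exists_mem_ring_iff
  obtain ⟨N, hN⟩ := hN
  refine ⟨N, fun f hf => ?_⟩
  have := (hr (r.symm f)).mpr (hN _ ((X_pow_dvd_algEquiv r.symm).mpr hf))
  simpa using this

/-- Multiplication by a nonzero component `z` on the finite-dimensional quotient satisfies a monic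
`P`, so `P(z) K[[t]] ⊆ R`. Write `P = X^k q` with `q(0) ≠ 0`: since `q(z)` is invertible in `R`,
already `z^k K[[t]] ⊆ R`. -/
theorem IsPrimitive.hasConductor {ψ : PlaneParam K} (h : ψ.IsPrimitive) : ψ.HasConductor := by
  obtain ⟨i, hi⟩ : ∃ i, ψ.hom (MvPowerSeries.X i) ≠ 0 := by
    rcases ψ.ne_zero with h | h
    · exact ⟨0, by rwa [hom_X_zero]⟩
    · exact ⟨1, by rwa [hom_X_one]⟩
  obtain ⟨z, hz⟩ : ∃ z, z = ψ.hom (MvPowerSeries.X i) := ⟨_, rfl⟩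
  rw [← hz] at hi
  have hzR : z ∈ ψ.ring := ⟨_, hz.symm⟩
  set W := Subalgebra.toSubmodule ψ.ring with hWdef
  have hW : W ≤ W.comap (LinearMap.mulLeft K z) := fun f hf => ψ.ring.mul_mem hzR hf
  have : Module.Finite K (PowerSeries K ⧸ W) := h
  let T : Module.End K (PowerSeries K ⧸ W) := W.mapQ W (LinearMap.mulLeft K z) hW
  obtain ⟨P, hPm, hP⟩ := Algebra.IsIntegral.isIntegral (R := K) T
  have hT : ∀ (P : Polynomial K) (f : PowerSeries K),
      Polynomial.aeval T P (W.mkQ f) = W.mkQ (Polynomial.aeval z P * f) := by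
    intro P
    induction P using Polynomial.induction_on' with
    | add p q hp hq => intro f; simp only [map_add, add_mul, LinearMap.add_apply, hp, hq]
    | monomial n c =>
      intro f
      rw [Polynomial.aeval_monomial, Polynomial.aeval_monomial]
      induction n generalizing f with
      | zero =>
        rw [pow_zero, mul_one, pow_zero, mul_one, ← Algebra.smul_def, map_smul]
        rfl
      | succ n ih =>
        rw [pow_succ, pow_succ, ← mul_assoc, Module.End.mul_apply]
        have : T (W.mkQ f) = W.mkQ (z * f) := rfl
        rw [this, ih]
        congr 1
        ring
  have hPR : ∀ f, Polynomial.aeval z P * f ∈ ψ.ring := by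
    intro f
    have := hT P f
    rw [show Polynomial.aeval T P = 0 from hP, LinearMap.zero_apply] at this
    exact (Submodule.Quotient.mk_eq_zero W).mp this.symm
  obtain ⟨q, hq, hq0⟩ :=
    Polynomial.exists_eq_pow_rootMultiplicity_mul_and_not_dvd P hPm.ne_zero 0
  set k := P.rootMultiplicity 0
  rw [Polynomial.C_0, sub_zero] at hq hq0
  rw [Polynomial.X_dvd_iff] at hq0
  -- The inverse is taken in `K[[x,y]]` and mapped to `K[[t]]`, which guarantees that it lies in the
  -- subring.
  have hqz : ∃ w ∈ ψ.ring, w * Polynomial.aeval z q = 1 := by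
    have hu : IsUnit (Polynomial.aeval (MvPowerSeries.X i : MvPowerSeries (Fin 2) K) q) := by
      rw [MvPowerSeries.isUnit_iff_constantCoeff]
      have : MvPowerSeries.constantCoeff
          (Polynomial.aeval (MvPowerSeries.X i : MvPowerSeries (Fin 2) K) q) = q.coeff 0 := by
        rw [Polynomial.aeval_def, Polynomial.hom_eval₂, MvPowerSeries.constantCoeff_X,
          Polynomial.eval₂_at_zero]
        simp [MvPowerSeries.algebraMap_apply]
      rw [this]
      exact (isUnit_iff_ne_zero.mpr hq0)
    obtain ⟨w, hw⟩ := hu.exists_left_inv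
    refine ⟨ψ.hom w, ⟨w, rfl⟩, ?_⟩
    rw [hz, Polynomial.aeval_algHom_apply, ← map_mul, hw, map_one]
  obtain ⟨w, hwR, hw⟩ := hqz
  obtain ⟨o, u, hu⟩ := exists_unit_mul_of_ne_zero hi
  refine ⟨o * k, ?_⟩
  rintro f ⟨g, rfl⟩
  have := ψ.ring.mul_mem hwR (hPR (↑(u⁻¹ ^ k) * g))
  convert this using 1
  rw [hq, map_mul, map_pow, Polynomial.aeval_X]
  have e : z ^ k * (↑(u⁻¹ ^ k) : PowerSeries K) = X ^ (o * k) := by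
    rw [hu, mul_pow, ← pow_mul, mul_assoc, ← Units.val_pow_eq_pow_val, ← Units.val_mul,
      inv_pow, mul_inv_cancel, Units.val_one, mul_one]
  calc X ^ (o * k) * g = (w * Polynomial.aeval z q) * (z ^ k * ↑(u⁻¹ ^ k)) * g := by
        rw [hw, e, one_mul]
    _ = _ := by ring

namespace HasConductor

variable {ψ : PlaneParam K}

/-- Orders are treated one by one from `n` up to a bound beyond which every series is in the ring: a
term whose order is a value is cancelled by a ring element, a term at a gap is left in `f - h`. -/
theorem exists_sub_coeff_eq_zero (hN : ψ.HasConductor) (n : ℕ) {f : PowerSeries K}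
    (hf : X ^ n ∣ f) :
    ∃ h ∈ ψ.ring, X ^ n ∣ h ∧ ∀ i ∈ ψ.semigroup, coeff i (f - h) = 0 := by
  obtain ⟨N, hN⟩ := hN
  have key : ∀ d n : ℕ, N ≤ n + d → ∀ f : PowerSeries K, X ^ n ∣ f →
      ∃ h ∈ ψ.ring, X ^ n ∣ h ∧ ∀ i ∈ ψ.semigroup, coeff i (f - h) = 0 := by
    intro d
    induction d with
    | zero => exact fun n hn f hf => ⟨f, hN f ((pow_dvd_pow X (by omega)).trans hf), hf, by simp⟩
    | succ d ih =>
      intro n hn f hf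
      by_cases hs : n ∈ ψ.semigroup
      · obtain ⟨g, hg, hgn⟩ := hs
        rw [order_eq_natCast_iff] at hgn
        obtain ⟨h, hh, hd, hc⟩ := ih (n + 1) (by omega) _
          (X_pow_succ_dvd_sub_smul hf hgn.1 hgn.2)
        refine ⟨(coeff n f / coeff n g) • g + h, ψ.ring.add_mem (ψ.ring.smul_mem hg _) hh,
          dvd_add (dvd_smul_right_of_dvd _ hgn.1) ((pow_dvd_pow X (Nat.le_succ n)).trans hd),
          fun i hi => ?_⟩
        rw [← sub_sub]; exact hc i hi
      · have hXn : X ^ (n + 1) ∣ f - (coeff n f / coeff n (X ^ n : PowerSeries K)) • X ^ n :=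
          X_pow_succ_dvd_sub_smul hf dvd_rfl (by simp)
        obtain ⟨h, hh, hd, hc⟩ := ih (n + 1) (by omega) _ hXn
        refine ⟨h, hh, (pow_dvd_pow X (Nat.le_succ n)).trans hd, fun i hi => ?_⟩
        have := hc i hi
        have hin : i ≠ n := fun e => hs (e ▸ hi)
        simpa [coeff_X_pow, hin] using this
  exact key N n (by omega) f hf

theorem conductor_spec (hN : ψ.HasConductor) :
    ψ.conductor ∈ {n | n ∈ ψ.semigroup ∧ ∀ m, n + m ∈ ψ.semigroup} := by
  obtain ⟨N, hN⟩ := hN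
  refine Nat.sInf_mem ⟨N, ?_⟩
  have : ∀ m, N + m ∈ ψ.semigroup := fun m =>
    ⟨X ^ (N + m), hN _ (pow_dvd_pow X (Nat.le_add_right N m)), order_X_pow _⟩
  exact ⟨this 0, this⟩

theorem mem_semigroup (hN : ψ.HasConductor) {n : ℕ} (hn : ψ.conductor ≤ n) :
    n ∈ ψ.semigroup := by
  have := hN.conductor_spec.2 (n - ψ.conductor)
  rwa [Nat.add_sub_cancel' hn] at this

theorem two_le_conductor (hN : ψ.HasConductor) (h1 : 1 ∉ ψ.semigroup) : 2 ≤ ψ.conductor := by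
  by_contra h
  exact h1 (hN.mem_semigroup (by omega))

theorem pred_conductor_notMem (hN : ψ.HasConductor) (h1 : 1 ∉ ψ.semigroup) :
    ψ.conductor - 1 ∉ ψ.semigroup := by
  have h2 := hN.two_le_conductor h1
  intro h
  have : ψ.conductor ≤ ψ.conductor - 1 := by
    refine Nat.sInf_le ⟨h, fun m => ?_⟩
    rcases Nat.eq_zero_or_pos m with rfl | hm
    · exact h
    · exact hN.mem_semigroup (by omega)
  omega

theorem mem_ring (hN : ψ.HasConductor) {f : PowerSeries K} (hf : X ^ ψ.conductor ∣ f) :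
    f ∈ ψ.ring := by
  obtain ⟨h, hh, hd, hc⟩ := hN.exists_sub_coeff_eq_zero _ hf
  have : f - h = 0 := by
    ext i
    by_cases hi : i < ψ.conductor
    · exact X_pow_dvd_iff.mp (dvd_sub hf hd) i hi
    · exact hc i (hN.mem_semigroup (by omega))
  rwa [sub_eq_zero.mp this]

/-- Otherwise powers of `x` would cancel the leading terms of `y` indefinitely, so `y`, and with it
the whole ring, would agree with series in `x` to any order. All values would then be multiples of
`a > 1`, against the existence of a conductor. -/
theorem exists_not_dvd_order (hN : ψ.HasConductor) (h1 : 1 ∉ ψ.semigroup) {a : ℕ}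
    (hx : ψ.x.order = a) :
    ∃ F : PowerSeries K, constantCoeff F = 0 ∧ ∃ b : ℕ, (ψ.y - ψ.homX F).order = b ∧ ¬ a ∣ b := by
  by_contra! H
  have ha0 : a ≠ 0 := by
    rintro rfl
    exact (order_eq_natCast_iff.mp hx).2 (by simpa using ψ.constantCoeff_x)
  have ha1 : a ≠ 1 := by
    rintro rfl
    exact h1 ⟨ψ.x, ψ.x_mem_ring, hx⟩
  have approx : ∀ n : ℕ, ∃ F, constantCoeff F = 0 ∧ X ^ n ∣ ψ.y - ψ.homX F := by
    intro n
    induction n with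
    | zero => exact ⟨0, by simp⟩
    | succ n ih =>
      obtain ⟨F, hF, hd⟩ := ih
      by_cases hc : coeff n (ψ.y - ψ.homX F) = 0
      · exact ⟨F, hF, X_pow_succ_dvd_iff.mpr ⟨hd, hc⟩⟩
      · obtain ⟨k, rfl⟩ := H F hF n (order_eq_natCast_iff.mpr ⟨hd, hc⟩)
        have hk : k ≠ 0 := by
          rintro rfl
          exact hc (by simp [ψ.constantCoeff_y, constantCoeff_homX, hF])
        have hxk : (ψ.x ^ k).order = (a * k : ℕ) := by
          rw [order_pow, hx, nsmul_eq_mul, mul_comm]; norm_cast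
        rw [order_eq_natCast_iff] at hxk
        have := X_pow_succ_dvd_sub_smul hd hxk.1 hxk.2
        set c := coeff (a * k) (ψ.y - ψ.homX F) / coeff (a * k) (ψ.x ^ k)
        refine ⟨F + c • X ^ k, by simp [hF, hk], ?_⟩
        rwa [map_add, map_smul, map_pow, homX_X, ← sub_sub]
  obtain ⟨N, hN⟩ := hN
  -- An order at least `N`, so that `t^M` lies in the ring, yet not divisible by `a`.
  set M := N * a + 1 with hM
  have hNM : N ≤ M := (Nat.le_mul_of_pos_right N (Nat.pos_of_ne_zero ha0)).trans (Nat.le_succ _)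
  obtain ⟨F, hF, hd⟩ := approx (M + 1)
  have happ : ∀ j ≤ M + 1, ∀ P, ∃ G, X ^ j ∣ ψ.hom P - ψ.homX G := by
    intro j
    induction j with
    | zero => exact fun _ P => ⟨0, by simp⟩
    | succ j ih =>
      intro hj P
      obtain ⟨G, Q, rfl⟩ := MvPowerSeries.exists_eq_inX_add P
      obtain ⟨G', hG'⟩ := ih (by omega) Q
      refine ⟨G + F * G', ?_⟩
      have e : ψ.hom (inX K G + MvPowerSeries.X 1 * Q) - ψ.homX (G + F * G')
          = (ψ.y - ψ.homX F) * ψ.hom Q + ψ.homX F * (ψ.hom Q - ψ.homX G') := by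
        rw [hom_inX_add, map_add, map_mul]; ring
      rw [e]
      refine dvd_add (((pow_dvd_pow X hj).trans hd).mul_right _) ?_
      rw [pow_succ']
      exact mul_dvd_mul (X_dvd_iff.mpr (by rw [constantCoeff_homX, hF])) hG'
  obtain ⟨P, hP⟩ := hN (X ^ M) (pow_dvd_pow X hNM)
  change ψ.hom P = X ^ M at hP
  obtain ⟨G, hG⟩ := happ (M + 1) le_rfl P
  rw [hP] at hG
  have := ψ.dvd_of_order_homX hx (order_eq_of_dvd_sub hG (Nat.lt_succ_self M) (order_X_pow M))
  rw [hM, Nat.dvd_add_right (Dvd.intro_left N rfl), Nat.dvd_one] at this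
  exact ha1 this

theorem exists_isAdapted_of_le (hN : ψ.HasConductor) (h1 : 1 ∉ ψ.semigroup)
    (hxy : ψ.x.order ≤ ψ.y.order) : ∃ (a b : ℕ) (φ : PlaneParam K),
      ψ.x.order = a ∧ ψ.AEquiv φ ∧ φ.IsAdapted a b := by
  have hx0 : ψ.x ≠ 0 := by
    intro h
    rw [h, order_zero, top_le_iff, order_eq_top] at hxy
    exact ψ.ne_zero.elim (fun h' => h' h) (fun h' => h' hxy)
  obtain ⟨a, hx⟩ : ∃ a : ℕ, ψ.x.order = a := ⟨_, (coe_toNat_order hx0).symm⟩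
  obtain ⟨F, hF, b, hb, hab⟩ := hN.exists_not_dvd_order h1 hx
  have hya : X ^ a ∣ ψ.y := X_pow_dvd_iff_le_order.mpr (hx ▸ hxy)
  have hxF : X ^ a ∣ ψ.homX F := by
    obtain ⟨G, rfl⟩ := X_dvd_iff.mpr hF
    rw [map_mul, homX_X]
    exact (order_eq_natCast_iff.mp hx).1.mul_right _
  have hle : a ≤ b := by
    have := X_pow_dvd_iff_le_order.mp (dvd_sub hya hxF)
    rw [hb] at this
    exact_mod_cast this
  let φ : PlaneParam K :=
    { x := ψ.x
      y := ψ.y - ψ.homX F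
      constantCoeff_x := ψ.constantCoeff_x
      constantCoeff_y := by simp [ψ.constantCoeff_y, constantCoeff_homX, hF]
      ne_zero := Or.inl hx0 }
  refine ⟨a, b, φ, hx, ?_, ⟨hx, hb, ?_, ?_, hab⟩⟩
  · have hX := sub_linear_mem_sq (X : PowerSeries K) (by simp) 0
    have hV := sub_linear_mem_sq (-F) (by simp [hF]) 1
    refine aequiv_of_det_ne_zero ψ φ _ _ ?_ ?_ _ _ _ _ hX hV ?_
    · rw [hom_inX_add, homX_X, map_zero, mul_zero, add_zero]
    · rw [hom_inX_add, map_neg, map_one, mul_one, neg_add_eq_sub]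
    · simp
  · refine Nat.pos_of_ne_zero ?_
    rintro rfl
    exact (order_eq_natCast_iff.mp hx).2 (by simpa using ψ.constantCoeff_x)
  · exact lt_of_le_of_ne hle (fun h => hab (h ▸ dvd_rfl))

theorem exists_isAdapted (hN : ψ.HasConductor) (h1 : 1 ∉ ψ.semigroup) :
    ∃ (a b : ℕ) (φ : PlaneParam K), ψ.AEquiv φ ∧ φ.IsAdapted a b := by
  rcases le_total ψ.x.order ψ.y.order with hxy | hxy
  · obtain ⟨a, b, φ, -, h⟩ := hN.exists_isAdapted_of_le h1 hxy
    exact ⟨a, b, φ, h⟩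
  · let χ : PlaneParam K :=
      { x := ψ.y
        y := ψ.x
        constantCoeff_x := ψ.constantCoeff_y
        constantCoeff_y := ψ.constantCoeff_x
        ne_zero := ψ.ne_zero.symm }
    have hχ : ψ.AEquiv χ := by
      refine aequiv_of_det_ne_zero ψ χ _ _ ψ.hom_X_one ψ.hom_X_zero 0 1 1 0 ?_ ?_ ?_
      · simp
      · simp
      · simp
    obtain ⟨a, b, φ, -, h, h'⟩ :=
      (hχ.hasConductor hN).exists_isAdapted_of_le (hχ.semigroup_eq ▸ h1) hxy
    exact ⟨a, b, φ, hχ.trans h, h'⟩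

end HasConductor

end PlaneParam

/-! ### Reparametrizations of `K[[t]]` -/

namespace PowerSeries

variable {K : Type*} [Field K]

/-- Prescribing `r.symm X` instead of `r X` means `r s = t`: the series `s` becomes the new
parameter, and `s^n` becomes `t^n`. -/
theorem exists_algEquiv_symm_X {s : PowerSeries K} (h0 : constantCoeff s = 0)
    (h1 : coeff 1 s ≠ 0) : ∃ r : PowerSeries K ≃ₐ[K] PowerSeries K, r.symm X = s := by
  have hs : HasSubst s := HasSubst.of_constantCoeff_zero' h0
  have hs' : HasSubst (s.substInvOfIsUnit h1.isUnit) :=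
    HasSubst.of_constantCoeff_zero' (constantCoeff_substInvOfIsUnit _ _)
  have e₁ : (substAlgHom hs' : PowerSeries K →ₐ[K] PowerSeries K).comp (substAlgHom hs)
      = AlgHom.id K _ := by
    refine AlgHom.ext fun f => ?_
    rw [AlgHom.comp_apply, coe_substAlgHom, coe_substAlgHom, subst_comp_subst_apply hs hs',
      subst_substInvOfIsUnit_right _ h0, X_subst]
    rfl
  have e₂ : (substAlgHom hs : PowerSeries K →ₐ[K] PowerSeries K).comp (substAlgHom hs')
      = AlgHom.id K _ := by
    refine AlgHom.ext fun f => ?_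
    rw [AlgHom.comp_apply, coe_substAlgHom, coe_substAlgHom, subst_comp_subst_apply hs' hs,
      subst_substInvOfIsUnit_left _ h0, X_subst]
    rfl
  exact ⟨AlgEquiv.ofAlgHom _ _ e₁ e₂, substAlgHom_X hs⟩

theorem X_pow_dvd_map_sub (f g : PowerSeries K →ₐ[K] PowerSeries K) {n : ℕ} (hg : X ∣ g X)
    (h : X ^ n ∣ f X - g X) (P : PowerSeries K) : X ^ n ∣ f P - g P := by
  have key : ∀ j ≤ n, ∀ P, X ^ j ∣ f P - g P := by
    intro j
    induction j with
    | zero => simp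
    | succ j ih =>
      intro hj P
      have hP := eq_X_mul_shift_add_const P
      generalize mk (fun p => coeff (p + 1) P) = G at hP
      have hC : ∀ ρ : PowerSeries K →ₐ[K] PowerSeries K,
          ρ (C (constantCoeff P)) = C (constantCoeff P) := fun ρ => ρ.commutes _
      have e : f P - g P = (f X - g X) * f G + g X * (f G - g G) := by
        generalize constantCoeff P = c at hP hC
        rw [hP, map_add, map_mul, hC, map_add, map_mul, hC]
        ring
      rw [e]
      refine dvd_add (((pow_dvd_pow _ hj).trans h).mul_right _) ?_
      rw [pow_succ']
      exact mul_dvd_mul hg (ih (by omega) G)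
  exact key n le_rfl P

/-- The effect of a substitution `t ↦ t + κ t ^ (l + 1) + ⋯` on the first terms of a series. -/
theorem X_pow_dvd_algEquiv_sub (r : PowerSeries K ≃ₐ[K] PowerSeries K) {l : ℕ} (hl : l ≠ 0)
    {κ : K} (h : X ^ (l + 2) ∣ r.symm X - (X + κ • X ^ (l + 1))) {k : ℕ} {f : PowerSeries K}
    (hf : X ^ k ∣ f) :
    X ^ (k + l + 1) ∣ r f - (f - (k * κ * coeff k f) • X ^ (k + l)) := by
  obtain ⟨l, rfl⟩ : ∃ m, l = m + 1 := ⟨l - 1, by omega⟩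
  obtain ⟨e₃, he₃⟩ := h
  have hs : r.symm X = X * (1 + X ^ (l + 1) * (C κ + X * e₃)) := by
    rw [sub_eq_iff_eq_add.mp he₃, smul_eq_C_mul]; ring
  obtain ⟨g₁, hg₁⟩ : X ^ k ∣ r f := (X_pow_dvd_algEquiv r).mpr hf
  obtain ⟨e, he⟩ := X_pow_dvd_map_sub (r.symm : PowerSeries K →ₐ[K] PowerSeries K)
    (AlgHom.id K _) (n := l + 2) dvd_rfl (by
      change _ ∣ r.symm X - X
      rw [hs]
      exact ⟨C κ + X * e₃, by ring⟩) g₁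
  change r.symm g₁ - g₁ = _ at he
  obtain ⟨E, hE⟩ := Polynomial.powAddExpansion 1 (X ^ (l + 1) * (C κ + X * e₃)) k
  have hc := eq_X_mul_shift_add_const g₁
  generalize mk (fun p => coeff (p + 1) g₁) = e₂ at hc
  obtain ⟨c, hcc⟩ : ∃ c, c = constantCoeff g₁ := ⟨_, rfl⟩
  rw [← hcc] at hc
  -- With `s = r.symm X` and `r f = t^k g₁`, the series `f` is `s^k` times `r.symm g₁`. The
  -- first-order term of the binomial expansion of `s^k` yields the factor `kκ`.
  have hff : f - r f = r.symm X ^ k * r.symm g₁ - X ^ k * g₁ := by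
    rw [← map_pow, ← map_mul, ← hg₁, r.symm_apply_apply]
  have key : X ^ (k + (l + 1) + 1) ∣ f - r f - (k * κ * c) • X ^ (k + (l + 1)) := by
    rw [hff, hs, mul_pow, hE, sub_eq_iff_eq_add.mp he, smul_eq_C_mul, map_mul, map_mul,
      map_natCast, hc]
    simp only [one_pow, mul_one]
    refine ⟨e + (k : PowerSeries K) * (C κ * e₂ + e₃ * C c + X * e₃ * e₂)
      + (k : PowerSeries K) * X ^ (l + 1) * (C κ + X * e₃) * e
      + E * X ^ l * (C κ + X * e₃) ^ 2 * (X * e₂ + C c + X ^ (l + 2) * e), ?_⟩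
    ring
  have hck : c = coeff k f := by
    have h1 : coeff k (r f) = c := by
      rw [hg₁, hcc, coeff_X_pow_mul', if_pos le_rfl, Nat.sub_self, coeff_zero_eq_constantCoeff]
    have h2 := X_pow_dvd_iff.mp key k (by omega)
    simp only [map_sub, coeff_smul, coeff_X_pow, h1] at h2
    rw [if_neg (by omega), smul_zero, sub_zero, sub_eq_zero] at h2
    exact h2.symm
  rw [hck] at key
  have := (dvd_neg).mpr key
  convert this using 1
  ring

/-- Hensel's lemma for `T^n - u` at the approximate root `1`, where the derivative is the unit `n`.
-/
theorem exists_pow_eq {n : ℕ} (hn : (n : K) ≠ 0) {u : PowerSeries K} (hu : X ∣ u - 1) :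
    ∃ w : PowerSeries K, w ^ n = u ∧ X ∣ w - 1 := by
  have hn0 : n ≠ 0 := by rintro rfl; simp at hn
  have hH : HenselianRing (PowerSeries K) (Ideal.span {X}) := inferInstance
  obtain ⟨w, hw, hw'⟩ := hH.is_henselian (Polynomial.X ^ n - Polynomial.C u)
    (Polynomial.monic_X_pow_sub_C u hn0) 1
    (by
      rw [Ideal.mem_span_singleton]
      simpa using (dvd_sub_comm.mp hu))
    (by
      have : IsUnit (n : PowerSeries K) := by
        rw [isUnit_iff_constantCoeff, map_natCast]; exact hn.isUnit
      simpa [Polynomial.derivative_X_pow] using this.map (Ideal.Quotient.mk (Ideal.span {X})))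
  refine ⟨w, ?_, Ideal.mem_span_singleton.mp hw'⟩
  simpa [Polynomial.IsRoot, sub_eq_zero] using hw

/-- Here `t^n + f = (tw)^n`, and `tw` becomes the new parameter. The second assertion records the
first correction, so that its effect on the other component can be computed. -/
theorem exists_algEquiv_map_eq_X_pow {n l : ℕ} (hn : (n : K) ≠ 0) (hl : l ≠ 0)
    {f : PowerSeries K} (hf : X ^ (n + l) ∣ f) :
    ∃ r : PowerSeries K ≃ₐ[K] PowerSeries K, r (X ^ n + f) = X ^ n ∧
      X ^ (l + 2) ∣ r.symm X - (X + (coeff (n + l) f / n) • X ^ (l + 1)) := by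
  obtain ⟨g, rfl⟩ := hf
  have hcf : coeff (n + l) (X ^ (n + l) * g) = constantCoeff g := by
    rw [coeff_X_pow_mul', if_pos le_rfl, Nat.sub_self, coeff_zero_eq_constantCoeff]
  obtain ⟨w, hw, hw1⟩ := exists_pow_eq hn (u := 1 + X ^ l * g)
    (by rw [add_sub_cancel_left]; exact (dvd_pow_self X hl).mul_right g)
  have hwc : constantCoeff w = 1 := by
    have := X_dvd_iff.mp hw1
    rwa [map_sub, map_one, sub_eq_zero] at this
  -- The cofactor in `w^n - 1 = q(w - 1)` has constant term `n`, hence is a unit; dividing by it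
  -- gives the leading term of `w - 1`.
  obtain ⟨q, hq⟩ : ∃ q, q = ∑ i ∈ Finset.range n, w ^ i := ⟨_, rfl⟩
  have hqw : q * (w - 1) = X ^ l * g := by
    rw [hq, geom_sum_mul, hw]; ring
  have hqc : constantCoeff q = n := by
    rw [hq, map_sum]; simp [hwc]
  have hqu : IsUnit q := by
    rw [isUnit_iff_constantCoeff, hqc]; exact hn.isUnit
  obtain ⟨v, hv⟩ : X ^ l ∣ w - 1 := (hqu.dvd_mul_left).mp (hqw ▸ Dvd.intro g rfl)
  have hqv : q * v = g := by
    have : X ^ l * (q * v) = X ^ l * g := by rw [← hqw, hv]; ring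
    exact mul_left_cancel₀ (pow_ne_zero l X_ne_zero) this
  have hvc : constantCoeff v = constantCoeff g / n := by
    rw [← hqv, map_mul, hqc, mul_div_cancel_left₀ _ hn]
  obtain ⟨r, hr⟩ := exists_algEquiv_symm_X (s := X * w) (by simp)
    (by
      have : coeff 1 (X * w) = coeff 0 w := coeff_succ_X_mul 0 w
      rw [this, coeff_zero_eq_constantCoeff, hwc]; exact one_ne_zero)
  refine ⟨r, ?_, ?_⟩
  · have e : X ^ n + X ^ (n + l) * g = r.symm X ^ n := by
      rw [hr, mul_pow, hw, pow_add]; ring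
    rw [e, ← map_pow, r.apply_symm_apply]
  · rw [hr, hcf, ← hvc]
    have e : X * w - (X + constantCoeff v • X ^ (l + 1))
        = X ^ (l + 1) * (v - C (constantCoeff v)) := by
      rw [sub_eq_iff_eq_add.mp hv, smul_eq_C_mul]; ring
    rw [e, pow_succ X (l + 1)]
    refine mul_dvd_mul_left _ (X_dvd_iff.mpr ?_)
    simp

theorem exists_algEquiv_symm_X_eq {l : ℕ} (hl : l ≠ 0) (κ : K) :
    ∃ r : PowerSeries K ≃ₐ[K] PowerSeries K, r.symm X = X + κ • X ^ (l + 1) := by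
  refine exists_algEquiv_symm_X (by simp) ?_
  simp [coeff_X_pow, hl]

end PowerSeries

/-! ### Gorenstein duality and the symmetry of the semigroup -/

/-- A monogenic order `S` containing `q B` is its own dual with respect to the top coordinate in
the basis of powers of the generator. -/
theorem PowerBasis.exists_dual {A B : Type*} [CommRing A] [IsDomain A] [CommRing B]
    [Algebra A B] [Module.IsTorsionFree A B] {S : Subalgebra A B} [Nontrivial S]
    (pb : PowerBasis A S) {q : A} (hq : q ≠ 0) (hS : ∀ b : B, q • b ∈ S) :
    ∃ τ : B →ₗ[A] A, (∀ w ∈ S, q ∣ τ w) ∧ ∀ w, (∀ r ∈ S, q ∣ τ (w * r)) → w ∈ S := by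
  have hd : 0 < pb.dim := pb.dim_pos
  let L : B →ₗ[A] S :=
    { toFun := fun b => ⟨q • b, hS b⟩
      map_add' := fun b c => Subtype.ext (smul_add q b c)
      map_smul' := fun c b => Subtype.ext (smul_comm q c b) }
  have hL : ∀ w (r : S), L (w * r) = L w * r := fun w r =>
    Subtype.ext (smul_mul_assoc q w (r : B)).symm
  have hL' : ∀ r : S, L (r : B) = q • r := fun r => rfl
  -- `τ b` is the top coordinate of `q b`; elements of `S` therefore have `τ` divisible by `q`.
  let last : Fin pb.dim := ⟨pb.dim - 1, by omega⟩
  let τ : B →ₗ[A] A := (pb.basis.coord last).comp L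
  have hτ : ∀ r : S, q ∣ τ (r : B) := fun r => by
    change q ∣ pb.basis.coord last (L (r : B))
    rw [hL', map_smul]
    exact Dvd.intro _ rfl
  refine ⟨τ, fun w hw => hτ ⟨w, hw⟩, ?_⟩
  have key : ∀ m ≤ pb.dim, ∀ w, (∀ r ∈ S, q ∣ τ (w * r)) →
      (∀ j : Fin pb.dim, m ≤ j → pb.basis.coord j (L w) = 0) → w ∈ S := by
    intro m
    induction m with
    | zero =>
      intro _ w _ h
      have : L w = 0 := pb.basis.ext_elem fun j => by
        simpa using h j (Nat.zero_le _)
      have h0 : q • w = 0 := congrArg Subtype.val this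
      rw [(smul_eq_zero.mp h0).resolve_left hq]
      exact zero_mem _
    | succ m ih =>
      intro hm w hw h
      let j₀ : Fin pb.dim := ⟨m, hm⟩
      -- This power of the generator moves the highest remaining coordinate, the one of index `m`,
      -- to the top. Lower powers stay below the top, so the minimal polynomial plays no role. The
      -- coordinate is thus divisible by `q`, and a multiple of `pb.gen ^ m` in `S` removes it from
      -- `w`.
      have htop : τ (w * (pb.gen ^ (pb.dim - 1 - m) : S))
          = pb.basis.coord j₀ (L w) := by
        change pb.basis.coord last (L _) = _
        rw [hL]
        conv_lhs => rw [← pb.basis.sum_repr (L w), Finset.sum_mul, map_sum]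
        rw [Finset.sum_eq_single j₀]
        · rw [smul_mul_assoc, map_smul, pb.basis_eq_pow, ← pow_add]
          have : pb.gen ^ ((j₀ : ℕ) + (pb.dim - 1 - m)) = pb.basis last := by
            rw [pb.basis_eq_pow]; congr 1; simp only [j₀, last]; omega
          rw [this, Module.Basis.coord_apply, pb.basis.repr_self, Finsupp.single_eq_same,
            smul_eq_mul, mul_one, Module.Basis.coord_apply]
        · intro i _ hi
          rcases lt_or_ge m (i : ℕ) with hmi | hmi
          · have := h i hmi
            rw [Module.Basis.coord_apply] at this
            rw [this, zero_smul, zero_mul, map_zero]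
          · have him : (i : ℕ) ≠ m := fun e => hi (Fin.ext e)
            rw [smul_mul_assoc, map_smul, pb.basis_eq_pow, ← pow_add]
            have hlt : (i : ℕ) + (pb.dim - 1 - m) < pb.dim := by omega
            have : pb.gen ^ ((i : ℕ) + (pb.dim - 1 - m)) = pb.basis ⟨_, hlt⟩ := by
              rw [pb.basis_eq_pow]
            rw [this]
            have hne : (⟨_, hlt⟩ : Fin pb.dim) ≠ last := by
              intro e
              have := congrArg Fin.val e
              simp only [last] at this
              omega
            rw [Module.Basis.coord_apply, pb.basis.repr_self, Finsupp.single_eq_of_ne hne.symm,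
              smul_zero]
        · simp
      obtain ⟨e, he⟩ : q ∣ pb.basis.coord j₀ (L w) := by
        rw [← htop]; exact hw _ (Subtype.prop _)
      let s : S := e • pb.gen ^ m
      have hs := ih (by omega) (w - s) (fun r hr => by
        rw [sub_mul, map_sub]
        exact dvd_sub (hw r hr) (hτ (s * ⟨r, hr⟩))) (fun j hj => by
          have hm' : pb.gen ^ m = pb.basis j₀ := by rw [pb.basis_eq_pow]
          rw [map_sub, hL', map_sub, map_smul, map_smul, hm']
          rcases hj.eq_or_lt with hj | hj
          · have : j = j₀ := Fin.ext hj.symm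
            subst this
            rw [he, Module.Basis.coord_apply, pb.basis.repr_self, Finsupp.single_eq_same,
              smul_eq_mul, smul_eq_mul, mul_one, sub_self]
          · have hne : j₀ ≠ j := fun e => by rw [← e] at hj; exact lt_irrefl _ hj
            rw [h j hj, Module.Basis.coord_apply, pb.basis.repr_self,
              Finsupp.single_eq_of_ne hne.symm, smul_zero, smul_zero, sub_zero])
      have := add_mem hs s.prop
      rwa [sub_add_cancel] at this
  exact fun w hw => key pb.dim le_rfl w hw fun j hj => absurd j.isLt (not_lt.mpr hj)

namespace PlaneParam

variable {K : Type*} [Field K]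

open PowerSeries

theorem homX_eq_expand {ψ : PlaneParam K} {a : ℕ} (ha : a ≠ 0) (hx : ψ.x = X ^ a)
    (F : PowerSeries K) : ψ.homX F = expand a ha F := by
  refine sub_eq_zero.mp (eq_zero_of_X_pow_dvd fun n => ?_)
  refine X_pow_dvd_map_sub ψ.homX (expand a ha) ?_ ?_ F
  · rw [expand_X]; exact dvd_pow_self X ha
  · rw [homX_X, hx, expand_X, sub_self]; exact dvd_zero _

theorem exists_sum_homX_mul {ψ : PlaneParam K} {a : ℕ} (ha : a ≠ 0) (hx : ψ.x = X ^ a)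
    (f : PowerSeries K) :
    ∃ g : ℕ → PowerSeries K, f = ∑ j ∈ Finset.range a, ψ.homX (g j) * X ^ j := by
  refine ⟨fun j => PowerSeries.mk fun k : ℕ => coeff (a * k + j) f, ?_⟩
  ext m
  rw [map_sum, Finset.sum_eq_single (m % a)]
  · rw [homX_eq_expand ha hx, coeff_mul_X_pow', if_pos (Nat.mod_le m a), coeff_expand,
      if_pos (Nat.dvd_sub_mod m), coeff_mk, Nat.mul_div_cancel' (Nat.dvd_sub_mod m),
      Nat.sub_add_cancel (Nat.mod_le m a)]
  · intro j hj hne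
    rw [homX_eq_expand ha hx, coeff_mul_X_pow']
    split_ifs with h
    · rw [coeff_expand, if_neg]
      intro hd
      refine hne ?_
      have := (Nat.modEq_iff_dvd' h).mpr hd
      rw [Nat.ModEq, Nat.mod_eq_of_lt (Finset.mem_range.mp hj)] at this
      exact this
    · rfl
  · intro h
    exact absurd (Finset.mem_range.mpr (Nat.mod_lt m (Nat.pos_of_ne_zero ha))) h

section dual

variable {B : Type*} [CommRing B] [Algebra (PowerSeries K) B]

/-- `B` is a copy of `K[[t]]` on which `F` acts as `F(x(t))`; a separate type keeps this action
apart from multiplication in `K[[t]]`. The powers `t^j` with `j < a` generate it. -/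
theorem finite_of_x_eq {ψ : PlaneParam K} {a : ℕ} (ha : a ≠ 0) (hx : ψ.x = X ^ a)
    (e : B ≃+* PowerSeries K) (he : ∀ F, e (algebraMap _ B F) = ψ.homX F) :
    Module.Finite (PowerSeries K) B := by
  classical
  refine ⟨⟨(Finset.range a).image fun j => e.symm (X ^ j), ?_⟩⟩
  refine eq_top_iff.mpr fun b _ => ?_
  obtain ⟨g, hg⟩ := exists_sum_homX_mul ha hx (e b)
  have hb : b = ∑ j ∈ Finset.range a, g j • e.symm (X ^ j) := by
    apply e.injective
    rw [hg, map_sum]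
    refine Finset.sum_congr rfl fun j _ => ?_
    rw [Algebra.smul_def, map_mul, he, e.apply_symm_apply]
  rw [hb]
  refine Submodule.sum_mem _ fun j hj => Submodule.smul_mem _ _ (Submodule.subset_span ?_)
  exact Finset.mem_coe.mpr (Finset.mem_image_of_mem _ hj)

/-- A parametrization with `x(t) = t ^ a` has `K[[x(t), y(t)]] = K[[x(t)]][y(t)]`. -/
theorem mem_adjoin_iff {ψ : PlaneParam K} (hN : ψ.HasConductor) {a : ℕ} (ha : a ≠ 0)
    (hx : ψ.x = X ^ a) (e : B ≃+* PowerSeries K) (he : ∀ F, e (algebraMap _ B F) = ψ.homX F)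
    (b : B) : b ∈ Algebra.adjoin (PowerSeries K) {e.symm ψ.y} ↔ e b ∈ ψ.ring := by
  have hfin := finite_of_x_eq ha hx e he
  let R : Subalgebra (PowerSeries K) B :=
    { carrier := {b | e b ∈ ψ.ring}
      mul_mem' := fun {b c} hb hc => by
        change e (b * c) ∈ ψ.ring; rw [map_mul]; exact ψ.ring.mul_mem hb hc
      add_mem' := fun {b c} hb hc => by
        change e (b + c) ∈ ψ.ring; rw [map_add]; exact ψ.ring.add_mem hb hc
      algebraMap_mem' := fun F => by
        change e _ ∈ ψ.ring; rw [he]; exact ψ.homX_mem_ring F }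
  have hle : Algebra.adjoin (PowerSeries K) {e.symm ψ.y} ≤ R := by
    refine Algebra.adjoin_le (Set.singleton_subset_iff.mpr ?_)
    change e (e.symm ψ.y) ∈ ψ.ring
    rw [e.apply_symm_apply]; exact ψ.y_mem_ring
  refine ⟨fun h => hle h, fun h => ?_⟩
  set S := Algebra.adjoin (PowerSeries K) {e.symm ψ.y}
  have hyS : e.symm ψ.y ∈ S := Algebra.subset_adjoin rfl
  have happ : ∀ (n : ℕ) (P : MvPowerSeries (Fin 2) K),
      ∃ s ∈ S, ∃ Q, ψ.hom P = e s + ψ.y ^ n * ψ.hom Q := by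
    intro n
    induction n with
    | zero => exact fun P => ⟨0, zero_mem _, P, by simp⟩
    | succ n ih =>
      intro P
      obtain ⟨s, hs, Q, hQ⟩ := ih P
      obtain ⟨F, T, rfl⟩ := MvPowerSeries.exists_eq_inX_add Q
      refine ⟨s + e.symm ψ.y ^ n * algebraMap _ B F,
        add_mem hs (mul_mem (pow_mem hyS n) (S.algebraMap_mem F)), T, ?_⟩
      rw [hQ, hom_inX_add, map_add, map_mul, map_pow, he, e.apply_symm_apply]
      ring
  -- Nakayama's lemma: modulo polynomials in `y`, an element of `R` is a multiple of `y^(a+N)`,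
  -- hence of `t^a t^N`, and so lies in `x R`.
  have hnak : Subalgebra.toSubmodule R ≤ Subalgebra.toSubmodule S := by
    refine Submodule.le_of_le_smul_of_le_jacobson_bot (I := Ideal.span {X})
      (IsNoetherian.noetherian _) ?_ ?_
    · refine le_trans ?_ (IsLocalRing.maximalIdeal_le_jacobson ⊥)
      rw [Ideal.span_le, Set.singleton_subset_iff, SetLike.mem_coe, IsLocalRing.mem_maximalIdeal,
        mem_nonunits_iff]
      exact X_prime.not_isUnit
    · rintro c ⟨P, hP⟩
      change ψ.hom P = e c at hP
      obtain ⟨N, hN⟩ := hN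
      obtain ⟨s, hs, Q, hQ⟩ := happ (a + N) P
      obtain ⟨y', hy'⟩ : X ^ (a + N) ∣ ψ.y ^ (a + N) :=
        pow_dvd_pow_of_dvd (X_dvd_iff.mpr ψ.constantCoeff_y) _
      have hmem : X ^ N * (y' * ψ.hom Q) ∈ ψ.ring := hN _ (Dvd.intro _ rfl)
      have hc : c = s + (X : PowerSeries K) • e.symm (X ^ N * (y' * ψ.hom Q)) := by
        apply e.injective
        rw [← hP, hQ, map_add, Algebra.smul_def, map_mul, he, homX_X, hx, e.apply_symm_apply, hy',
          pow_add]
        ring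
      rw [hc]
      refine Submodule.add_mem_sup hs
        (Submodule.smul_mem_smul (Ideal.mem_span_singleton_self X) ?_)
      change e (e.symm _) ∈ ψ.ring
      rwa [e.apply_symm_apply]
  exact hnak h

theorem exists_dual_of_algebra {ψ : PlaneParam K} (hN : ψ.HasConductor) {a : ℕ} (ha : a ≠ 0)
    (hx : ψ.x = X ^ a) (e : B ≃+* PowerSeries K) (he : ∀ F, e (algebraMap _ B F) = ψ.homX F) :
    ∃ Λ : PowerSeries K →ₗ[K] K, (∀ w ∈ ψ.ring, Λ w = 0) ∧
      ∀ w, (∀ r ∈ ψ.ring, Λ (w * r) = 0) → w ∈ ψ.ring := by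
  have hfin := finite_of_x_eq ha hx e he
  have hdom : IsDomain B := MulEquiv.isDomain (PowerSeries K) e.toMulEquiv
  have hinj : Function.Injective (algebraMap (PowerSeries K) B) := by
    rw [injective_iff_map_eq_zero]
    intro F hF
    have h := he F
    rw [hF, map_zero, homX_eq_expand ha hx] at h
    ext n
    have := coeff_expand_mul a ha F n
    rw [← h] at this
    simpa using this.symm
  have htf : Module.IsTorsionFree (PowerSeries K) B :=
    Module.isTorsionFree_iff_algebraMap_injective.mpr hinj
  have hS := mem_adjoin_iff hN ha hx e he
  obtain ⟨N, hN⟩ := hN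
  have hq : ∀ b : B, (X ^ (N + 1) : PowerSeries K) • b ∈
      Algebra.adjoin (PowerSeries K) {e.symm ψ.y} := by
    intro b
    rw [hS, Algebra.smul_def, map_mul, he, map_pow, homX_X, hx, ← pow_mul]
    refine hN _ (Dvd.dvd.mul_right (pow_dvd_pow X ?_) _)
    exact (Nat.le_succ N).trans (Nat.le_mul_of_pos_left _ (Nat.pos_of_ne_zero ha))
  obtain ⟨τ, h₁, h₂⟩ := PowerBasis.exists_dual
    (Algebra.adjoin.powerBasis' (Algebra.IsIntegral.isIntegral (e.symm ψ.y)))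
    (pow_ne_zero (N + 1) X_ne_zero) hq
  have hsmul : ∀ (c : K) (w : PowerSeries K),
      e.symm (c • w) = (C c : PowerSeries K) • e.symm w := by
    intro c w
    apply e.injective
    rw [e.apply_symm_apply, smul_eq_C_mul, Algebra.smul_def, map_mul, he, e.apply_symm_apply]
    congr 1
    exact (ψ.homX.commutes c).symm
  refine ⟨{ toFun := fun w => coeff N (τ (e.symm w))
            map_add' := fun v w => by simp
            map_smul' := fun c w => by
              rw [hsmul, map_smul, smul_eq_mul, coeff_C_mul]; rfl }, ?_, ?_⟩
  · intro w hw
    have := h₁ (e.symm w) ((hS _).mpr (by rwa [e.apply_symm_apply]))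
    exact X_pow_dvd_iff.mp this N (Nat.lt_succ_self N)
  · intro w hw
    have := h₂ (e.symm w) ?_
    · rw [hS, e.apply_symm_apply] at this
      exact this
    · intro r hr
      rw [hS] at hr
      rw [X_pow_dvd_iff]
      intro k hk
      -- `Λ` reads only the coefficient of degree `N`; multiplying by powers of `x` brings every
      -- lower coefficient of `τ` there.
      have h := hw (ψ.x ^ (N - k) * e r) (ψ.ring.mul_mem (ψ.ring.pow_mem ψ.x_mem_ring _) hr)
      have hmul : e.symm (w * (ψ.x ^ (N - k) * e r))
          = (X ^ (N - k) : PowerSeries K) • (e.symm w * r) := by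
        apply e.injective
        rw [e.apply_symm_apply, Algebra.smul_def, map_mul e, he, map_mul e, map_pow, homX_X,
          e.apply_symm_apply]
        ring
      change coeff N (τ (e.symm _)) = 0 at h
      rw [hmul, map_smul, smul_eq_mul, coeff_X_pow_mul', if_pos (Nat.sub_le _ _)] at h
      rwa [show N - (N - k) = k by omega] at h

end dual

/-- The ring of a parametrization is Gorenstein: it is its own annihilator for the pairing defined
by a linear functional. -/
theorem exists_dual {ψ : PlaneParam K} (hN : ψ.HasConductor) {a : ℕ} (ha : a ≠ 0)
    (hx : ψ.x = X ^ a) :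
    ∃ Λ : PowerSeries K →ₗ[K] K, (∀ w ∈ ψ.ring, Λ w = 0) ∧
      ∀ w, (∀ r ∈ ψ.ring, Λ (w * r) = 0) → w ∈ ψ.ring :=
  @exists_dual_of_algebra K _ (PowerSeries K) _ (ψ.homX : PowerSeries K →+* PowerSeries K).toAlgebra
    ψ hN a ha hx (RingEquiv.refl _) (fun _ => rfl)

/-- The symmetry of the semigroup of values. -/
theorem conductor_sub_mem_semigroup {ψ : PlaneParam K} (hN : ψ.HasConductor)
    (h1 : 1 ∉ ψ.semigroup) {a : ℕ} (ha : a ≠ 0) (hx : ψ.x = X ^ a) {z : ℕ}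
    (hz : z ∉ ψ.semigroup) : ψ.conductor - 1 - z ∈ ψ.semigroup := by
  obtain ⟨Λ, h₁, h₂⟩ := exists_dual hN ha hx
  have hc2 := hN.two_le_conductor h1
  have hzc : z < ψ.conductor := not_le.mp fun h => hz (hN.mem_semigroup h)
  -- From here on `c` is the largest gap, one less than the conductor.
  obtain ⟨c, hc⟩ : ∃ c, ψ.conductor = c + 1 := ⟨ψ.conductor - 1, by omega⟩
  have hgap := hN.pred_conductor_notMem h1
  rw [hc, Nat.add_sub_cancel] at hgap ⊢
  have hR : ∀ {f : PowerSeries K}, X ^ (c + 1) ∣ f → f ∈ ψ.ring := fun h =>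
    hN.mem_ring (hc ▸ h)
  have hΛ : ∀ {f : PowerSeries K}, X ^ (c + 1) ∣ f → Λ f = 0 := fun h => h₁ _ (hR h)
  have hΛc : ∀ {f : PowerSeries K}, X ^ c ∣ f → Λ f = coeff c f * Λ (X ^ c) := by
    intro f hf
    have := hΛ (X_pow_succ_dvd_sub_smul hf (dvd_refl (X ^ c)) (by simp))
    rw [map_sub, map_smul, sub_eq_zero] at this
    simpa using this
  -- Otherwise `t^c` would be orthogonal to the ring, hence in it, although `c` is a gap.
  have hΛ0 : Λ (X ^ c) ≠ 0 := by
    intro h0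
    refine hgap ⟨X ^ c, h₂ _ fun r _ => ?_, order_X_pow c⟩
    rw [hΛc (Dvd.intro _ rfl), h0, mul_zero]
  by_contra hcz
  -- If `c - z` were a gap too, some `w` of order `z` could be made orthogonal to the whole ring,
  -- hence would lie in it, against `z` being a gap. Orthogonality is extended to ring elements of
  -- lower and lower order.
  have key : ∀ d ≤ c + 1, ∃ w : PowerSeries K, X ^ (z + 1) ∣ w - X ^ z ∧
      ∀ r ∈ ψ.ring, X ^ (c + 1 - d) ∣ r → Λ (w * r) = 0 := by
    intro d
    induction d with
    | zero => exact fun _ => ⟨X ^ z, by simp, fun r _ hr => hΛ (hr.mul_left _)⟩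
    | succ d ih =>
      intro hd
      obtain ⟨w, hw, hwr⟩ := ih (by omega)
      obtain ⟨n, hn⟩ : ∃ n, c + 1 - d = n + 1 := ⟨c - d, by omega⟩
      rw [hn] at hwr
      rw [show c + 1 - (d + 1) = n by omega]
      have hXw : X ^ z ∣ w := by
        have := dvd_add ((pow_dvd_pow X (Nat.le_succ z)).trans hw) (dvd_refl (X ^ z))
        rwa [sub_add_cancel] at this
      have reduce : ∀ v : PowerSeries K, (∀ r ∈ ψ.ring, X ^ (n + 1) ∣ r → Λ (v * r) = 0) →
          ∀ g ∈ ψ.ring, g.order = n → Λ (v * g) = 0 →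
            ∀ r ∈ ψ.ring, X ^ n ∣ r → Λ (v * r) = 0 := by
        intro v hv g hg hgn hvg r hr hrn
        rw [order_eq_natCast_iff] at hgn
        have := hv _ (ψ.ring.sub_mem hr (ψ.ring.smul_mem hg _))
          (X_pow_succ_dvd_sub_smul hrn hgn.1 hgn.2)
        rw [mul_sub, map_sub, mul_smul_comm, map_smul, hvg, smul_zero, sub_zero] at this
        exact this
      by_cases hs : n ∈ ψ.semigroup
      · obtain ⟨g, hg, hgn⟩ := hs
        obtain ⟨hgd, hgc⟩ := order_eq_natCast_iff.mp hgn
        rcases lt_or_ge c (n + z) with hlt | hge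
        · refine ⟨w, hw, reduce w hwr g hg hgn (hΛ ?_)⟩
          refine (pow_dvd_pow X (show c + 1 ≤ z + n by omega)).trans ?_
          rw [pow_add]; exact mul_dvd_mul hXw hgd
        -- Since `c - z` is not a value, `n + z < c`. So `t^(c-n)` has order above `z`; it pairs to
        -- zero with ring elements of order above `n`, but not with `g`.
        · have hne : n + z ≠ c := fun h => hcz (by
            rw [show c - z = n by omega]; exact ⟨g, hg, hgn⟩)
          have hXg : X ^ c ∣ X ^ (c - n) * g := by
            rw [show c = (c - n) + n by omega, pow_add, Nat.add_sub_cancel]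
            exact mul_dvd_mul_left _ hgd
          have hcg : Λ (X ^ (c - n) * g) ≠ 0 := by
            rw [hΛc hXg, coeff_X_pow_mul', if_pos (Nat.sub_le _ _), show c - (c - n) = n by omega]
            exact mul_ne_zero hgc hΛ0
          refine ⟨w - (Λ (w * g) / Λ (X ^ (c - n) * g)) • X ^ (c - n), ?_,
            reduce _ (fun r hr hrn => ?_) g hg hgn ?_⟩
          · rw [sub_right_comm]
            exact dvd_sub hw (dvd_smul_right_of_dvd _ (pow_dvd_pow X (by omega)))
          · have h0 : Λ (X ^ (c - n) * r) = 0 := hΛ (by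
              rw [show c + 1 = (c - n) + (n + 1) by omega, pow_add]
              exact mul_dvd_mul_left _ hrn)
            rw [sub_mul, map_sub, hwr r hr hrn, smul_mul_assoc, map_smul, h0, smul_zero, sub_zero]
          · rw [sub_mul, map_sub, smul_mul_assoc, map_smul, smul_eq_mul, div_mul_cancel₀ _ hcg,
              sub_self]
      · refine ⟨w, hw, fun r hr hrn => hwr r hr (X_pow_succ_dvd_iff.mpr ⟨hrn, ?_⟩)⟩
        by_contra hne
        exact hs ⟨r, hr, order_eq_natCast_iff.mpr ⟨hrn, hne⟩⟩
  obtain ⟨w, hw, hwr⟩ := key (c + 1) le_rfl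
  refine hz ⟨w, h₂ w fun r hr => hwr r hr (by simp), ?_⟩
  exact order_eq_of_dvd_sub (dvd_sub_comm.mp hw) (Nat.lt_succ_self z) (order_X_pow z)

end PlaneParam

/-! ### Short parametrizations and removal of the exponent `c - 1` -/

namespace PlaneParam

variable {K : Type*} [Field K]

open PowerSeries

theorem order_eq_of_dvd_sub_X_pow {f : PowerSeries K} {n : ℕ} (h : X ^ (n + 1) ∣ f - X ^ n) :
    f.order = n :=
  order_eq_of_dvd_sub (dvd_sub_comm.mp h) (Nat.lt_succ_self n) (order_X_pow n)

theorem coeff_eq_one_of_dvd_sub_X_pow {f : PowerSeries K} {n : ℕ} (h : X ^ (n + 1) ∣ f - X ^ n) :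
    coeff n f = 1 := by
  have := X_pow_dvd_iff.mp h n (Nat.lt_succ_self n)
  rwa [map_sub, coeff_X_pow_self, sub_eq_zero] at this

theorem dvd_algEquiv_sub_X_pow (r : PowerSeries K ≃ₐ[K] PowerSeries K) {l : ℕ} (hl : l ≠ 0)
    {κ : K} (hr : X ^ (l + 2) ∣ r.symm X - (X + κ • X ^ (l + 1))) {n : ℕ} {f : PowerSeries K}
    (hf : X ^ (n + 1) ∣ f - X ^ n) : X ^ (n + 1) ∣ r f - X ^ n := by
  have h := X_pow_dvd_algEquiv_sub r hl hr (order_eq_natCast_iff.mp (order_eq_of_dvd_sub_X_pow hf)).1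
  generalize (n : K) * κ * coeff n f = e at h
  have e' : r f - X ^ n = (r f - (f - e • X ^ (n + l))) + (f - X ^ n) - e • X ^ (n + l) := by ring
  rw [e']
  exact dvd_sub (dvd_add ((pow_dvd_pow X (by omega)).trans h) hf)
    (dvd_smul_right_of_dvd _ (pow_dvd_pow X (by omega)))

theorem coeff_powAdd (n : ℕ) (S : Set ℕ) (α : ℕ → K) (i : ℕ) :
    coeff i (powAdd n S α) = (if i = n then 1 else 0) + {i | i ∈ S ∧ n < i}.indicator α i := by
  rw [powAdd, map_add, coeff_X_pow, coeff_mk]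

theorem dvd_powAdd_sub (n : ℕ) (S : Set ℕ) (α : ℕ → K) :
    X ^ (n + 1) ∣ powAdd n S α - X ^ n := by
  rw [powAdd, add_sub_cancel_left, X_pow_dvd_iff]
  intro m hm
  rw [coeff_mk, Set.indicator_of_notMem]
  exact fun h => absurd h.2 (by omega)

theorem eq_powAdd {f : PowerSeries K} {n : ℕ} {S : Set ℕ} (h : X ^ (n + 1) ∣ f - X ^ n)
    (hS : ∀ i, n < i → i ∉ S → coeff i f = 0) : f = powAdd n S fun i => coeff i f := by
  classical
  ext i
  rw [coeff_powAdd, Set.indicator_apply]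
  rcases lt_trichotomy i n with hi | rfl | hi
  · have := X_pow_dvd_iff.mp h i (by omega)
    rw [map_sub, coeff_X_pow, if_neg hi.ne, sub_zero] at this
    rw [this, if_neg hi.ne, if_neg (fun h => absurd h.2 (by omega)), add_zero]
  · rw [coeff_eq_one_of_dvd_sub_X_pow h, if_pos rfl,
      if_neg (fun h => absurd h.2 (lt_irrefl _)), add_zero]
  · rw [if_neg hi.ne', zero_add]
    by_cases hiS : i ∈ S
    · rw [if_pos ⟨hiS, hi⟩]
    · rw [hS i hi hiS, if_neg (fun h => hiS h.1)]

theorem AEquiv.gaps_eq {ψ φ : PlaneParam K} (h : ψ.AEquiv φ) : φ.gaps = ψ.gaps := by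
  rw [gaps, gaps, h.semigroup_eq]

theorem AEquiv.smallGaps_eq {ψ φ : PlaneParam K} (h : ψ.AEquiv φ) :
    φ.smallGaps = ψ.smallGaps := by
  rw [smallGaps, smallGaps, h.semigroup_eq, h.conductor_eq]

namespace HasConductor

variable {ψ : PlaneParam K}

theorem powAdd_gaps_eq (hN : ψ.HasConductor) {n : ℕ} (hn : ψ.conductor ≤ n + 1) (α : ℕ → K) :
    powAdd n ψ.gaps α = powAdd n ψ.smallGaps α := by
  have : ∀ i, n < i → i ∈ ψ.semigroup := fun i hi => hN.mem_semigroup (by omega)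
  rw [powAdd, powAdd]
  congr 3
  ext i
  exact ⟨fun h => absurd (this i h.2) h.1, fun h => absurd (this i h.2) h.1.1⟩

theorem powAdd_gaps_sub (hN : ψ.HasConductor) (h1 : 1 ∉ ψ.semigroup) {n : ℕ}
    (hn : n + 1 < ψ.conductor) (α : ℕ → K) :
    powAdd n ψ.gaps α - coeff (ψ.conductor - 1) (powAdd n ψ.gaps α) • X ^ (ψ.conductor - 1)
      = powAdd n ψ.smallGaps α := by
  classical
  have hgap := hN.pred_conductor_notMem h1
  ext i
  rw [map_sub, coeff_smul, coeff_X_pow, coeff_powAdd, coeff_powAdd, coeff_powAdd,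
    Set.indicator_apply, Set.indicator_apply, Set.indicator_apply]
  by_cases hi : i = ψ.conductor - 1
  · subst hi
    have m₁ : ψ.conductor - 1 ∈ {i | i ∈ ψ.gaps ∧ n < i} := ⟨hgap, by omega⟩
    have m₂ : ψ.conductor - 1 ∉ {i | i ∈ ψ.smallGaps ∧ n < i} :=
      fun h => absurd h.1.2 (by omega)
    rw [if_pos m₁, if_neg m₂, if_neg (by omega)]
    simp
  · have : (i ∈ {i | i ∈ ψ.gaps ∧ n < i}) ↔ (i ∈ {i | i ∈ ψ.smallGaps ∧ n < i}) := by
      refine ⟨fun h => ⟨⟨h.1, ?_⟩, h.2⟩, fun h => ⟨h.1.1, h.2⟩⟩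
      have : i < ψ.conductor := not_le.mp fun hc => h.1 (hN.mem_semigroup hc)
      omega
    simp only [this, if_neg hi, smul_zero, sub_zero]

theorem exists_sub_eq_powAdd (hN : ψ.HasConductor) {n : ℕ} {f : PowerSeries K}
    (hf : X ^ (n + 1) ∣ f - X ^ n) :
    ∃ α, f - powAdd n ψ.gaps α ∈ ψ.ring := by
  -- The reduction is applied to `f - t^n`, so that the leading term survives even when `n` is a
  -- value.
  obtain ⟨h, hh, hd, hc⟩ := hN.exists_sub_coeff_eq_zero _ hf
  refine ⟨fun i => coeff i (f - h), ?_⟩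
  rw [← eq_powAdd (f := f - h) (n := n)]
  · rwa [sub_sub_cancel]
  · rw [sub_right_comm]; exact dvd_sub hf hd
  · intro i hi hiS
    have := hc i (not_not.mp hiS)
    rw [sub_right_comm, map_sub, coeff_X_pow, if_neg hi.ne', sub_zero] at this
    exact this

end HasConductor

/-- An adapted parametrization whose components have leading coefficient one. -/
structure IsNormalized (ψ : PlaneParam K) (a b : ℕ) : Prop where
  pos : 0 < a
  lt : a < b
  not_dvd : ¬ a ∣ b
  dvd_x : X ^ (a + 1) ∣ ψ.x - X ^ a
  dvd_y : X ^ (b + 1) ∣ ψ.y - X ^ b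

namespace IsNormalized

variable {ψ : PlaneParam K} {a b : ℕ}

theorem isAdapted (h : ψ.IsNormalized a b) : ψ.IsAdapted a b :=
  { h with
    order_x := order_eq_of_dvd_sub_X_pow h.dvd_x
    order_y := order_eq_of_dvd_sub_X_pow h.dvd_y }

theorem reparam (h : ψ.IsNormalized a b) (r : PowerSeries K ≃ₐ[K] PowerSeries K) {l : ℕ}
    (hl : l ≠ 0) {κ : K} (hr : X ^ (l + 2) ∣ r.symm X - (X + κ • X ^ (l + 1))) :
    (ψ.reparam r).IsNormalized a b :=
  { h with
    dvd_x := dvd_algEquiv_sub_X_pow r hl hr h.dvd_x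
    dvd_y := dvd_algEquiv_sub_X_pow r hl hr h.dvd_y }

theorem exists_aequiv (h : ψ.IsNormalized a b) {u v : PowerSeries K} (hu : ψ.x - u ∈ ψ.ring)
    (hv : ψ.y - v ∈ ψ.ring) (hua : X ^ (a + 1) ∣ u - X ^ a) (hvb : X ^ (b + 1) ∣ v - X ^ b) :
    ∃ φ : PlaneParam K, ψ.AEquiv φ ∧ φ.IsNormalized a b ∧ φ.x = u ∧ φ.y = v := by
  have hu' := ψ.ring.sub_mem ψ.x_mem_ring hu
  have hv' := ψ.ring.sub_mem ψ.y_mem_ring hv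
  rw [sub_sub_cancel] at hu' hv'
  obtain ⟨φ, hφ, rfl, rfl⟩ := h.isAdapted.aequivTo hu' hv' (order_eq_of_dvd_sub_X_pow hua)
    (order_eq_of_dvd_sub_X_pow hvb)
  exact ⟨φ, hφ, { h with dvd_x := hua, dvd_y := hvb }, rfl, rfl⟩

theorem exists_aequiv_powAdd (h : ψ.IsNormalized a b) (hN : ψ.HasConductor) :
    ∃ (α β : ℕ → K) (φ : PlaneParam K), ψ.AEquiv φ ∧ φ.IsNormalized a b ∧
      φ.x = powAdd a ψ.gaps α ∧ φ.y = powAdd b ψ.gaps β := by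
  obtain ⟨α, hα⟩ := hN.exists_sub_eq_powAdd h.dvd_x
  obtain ⟨β, hβ⟩ := hN.exists_sub_eq_powAdd h.dvd_y
  exact ⟨α, β, h.exists_aequiv hα hβ (dvd_powAdd_sub _ _ _) (dvd_powAdd_sub _ _ _)⟩

theorem exists_aequiv_X_pow_left (h : ψ.IsNormalized a b) (hN : ψ.HasConductor)
    (ha : (a : K) ≠ 0) : ∃ (β : ℕ → K) (φ : PlaneParam K), ψ.AEquiv φ ∧ φ.IsNormalized a b ∧
      φ.x = X ^ a ∧ φ.y = powAdd b ψ.gaps β := by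
  obtain ⟨r, hrx, hr⟩ := exists_algEquiv_map_eq_X_pow ha one_ne_zero h.dvd_x
  rw [add_sub_cancel] at hrx
  have hχ := ψ.reparam_aequiv r
  have hn := h.reparam r one_ne_zero hr
  obtain ⟨β, hβ⟩ := (hχ.hasConductor hN).exists_sub_eq_powAdd hn.dvd_y
  obtain ⟨φ, hφ, h', hx, hy⟩ := hn.exists_aequiv (u := X ^ a)
    (by rw [show (ψ.reparam r).x = X ^ a from hrx, sub_self]; exact zero_mem _) hβ
    (by rw [sub_self]; exact dvd_zero _) (dvd_powAdd_sub _ _ _)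
  exact ⟨β, φ, hχ.trans hφ, h', hx, by rw [hy, hχ.gaps_eq]⟩

theorem exists_aequiv_X_pow_right (h : ψ.IsNormalized a b) (hN : ψ.HasConductor)
    (hb : (b : K) ≠ 0) : ∃ (α : ℕ → K) (φ : PlaneParam K), ψ.AEquiv φ ∧ φ.IsNormalized a b ∧
      φ.x = powAdd a ψ.gaps α ∧ φ.y = X ^ b := by
  obtain ⟨r, hry, hr⟩ := exists_algEquiv_map_eq_X_pow hb one_ne_zero h.dvd_y
  rw [add_sub_cancel] at hry
  have hχ := ψ.reparam_aequiv r
  have hn := h.reparam r one_ne_zero hr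
  obtain ⟨α, hα⟩ := (hχ.hasConductor hN).exists_sub_eq_powAdd hn.dvd_x
  obtain ⟨φ, hφ, h', hx, hy⟩ := hn.exists_aequiv (v := X ^ b) hα
    (by rw [show (ψ.reparam r).y = X ^ b from hry, sub_self]; exact zero_mem _)
    (dvd_powAdd_sub _ _ _) (by rw [sub_self]; exact dvd_zero _)
  exact ⟨α, φ, hχ.trans hφ, h', by rw [hx, hχ.gaps_eq], hy⟩

end IsNormalized

/-- The choice `l = c - 1 - n` makes the leading term act in degree `c - 1`, and the condition on
`κ` cancels the coefficient there. What remains has order at least the conductor, so it lies in the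
ring. -/
theorem HasConductor.dvd_algEquiv_powAdd_sub {ψ : PlaneParam K} (hN : ψ.HasConductor)
    (h1 : 1 ∉ ψ.semigroup) {n : ℕ} (hn : n + 1 < ψ.conductor) {β : ℕ → K} {κ : K}
    (hκ : n * κ = coeff (ψ.conductor - 1) (powAdd n ψ.gaps β))
    {r : PowerSeries K ≃ₐ[K] PowerSeries K} {l : ℕ} (hl : l = ψ.conductor - 1 - n)
    (hr : X ^ (l + 2) ∣ r.symm X - (X + κ • X ^ (l + 1))) :
    X ^ ψ.conductor ∣ r (powAdd n ψ.gaps β) - powAdd n ψ.smallGaps β := by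
  have hd := dvd_powAdd_sub n ψ.gaps β
  have := X_pow_dvd_algEquiv_sub r (by omega) hr
    (order_eq_natCast_iff.mp (order_eq_of_dvd_sub_X_pow hd)).1
  rwa [coeff_eq_one_of_dvd_sub_X_pow hd, mul_one, hκ, show n + l = ψ.conductor - 1 by omega,
    hN.powAdd_gaps_sub h1 hn, Nat.sub_add_cancel (by omega)] at this

namespace IsNormalized

variable {ψ : PlaneParam K} {a b : ℕ}

theorem aequivTo_smallGaps_right (h : ψ.IsNormalized a b) (hN : ψ.HasConductor)
    (h1 : 1 ∉ ψ.semigroup) (hb : (b : K) ≠ 0) :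
    ∃ α β : ℕ → K, ψ.AEquivTo (powAdd a ψ.gaps α) (powAdd b ψ.smallGaps β) := by
  obtain ⟨α, β, φ, hφ, hn, hx, hy⟩ := h.exists_aequiv_powAdd hN
  -- If `c - 1 ≤ b`, no gap exceeds `b` and there is nothing to remove. Otherwise the exponent of
  -- the substitution is positive.
  rcases le_or_gt ψ.conductor (b + 1) with hc | hc
  · exact ⟨α, β, φ, hφ, hx, by rw [hy, hN.powAdd_gaps_eq hc]⟩
  obtain ⟨r, hr⟩ := exists_algEquiv_symm_X_eq (show ψ.conductor - 1 - b ≠ 0 by omega)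
    (coeff (ψ.conductor - 1) (powAdd b ψ.gaps β) / b)
  have hr' := (sub_eq_zero.mpr hr) ▸ dvd_zero (X ^ (ψ.conductor - 1 - b + 2) : PowerSeries K)
  have hd := hN.dvd_algEquiv_powAdd_sub h1 hc (mul_div_cancel₀ _ hb) rfl hr'
  have hχ := hφ.trans (φ.reparam_aequiv r)
  have hn' := hn.reparam r (by omega) hr'
  have hNχ := hχ.hasConductor hN
  obtain ⟨α', hα'⟩ := hNχ.exists_sub_eq_powAdd hn'.dvd_x
  obtain ⟨θ, hθ, -, hx', hy'⟩ := hn'.exists_aequiv hα'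
    (hNχ.mem_ring (by
      rw [hχ.conductor_eq, show (φ.reparam r).y = r (powAdd b ψ.gaps β) from congrArg r hy]
      exact hd)) (dvd_powAdd_sub _ _ _) (dvd_powAdd_sub _ _ _)
  exact ⟨α', β, θ, hχ.trans hθ, by rw [hx', hχ.gaps_eq], hy'⟩

theorem aequivTo_smallGaps_left (h : ψ.IsNormalized a b) (hN : ψ.HasConductor)
    (h1 : 1 ∉ ψ.semigroup) (ha : (a : K) ≠ 0) :
    ∃ α β : ℕ → K, ψ.AEquivTo (powAdd a ψ.smallGaps α) (powAdd b ψ.gaps β) := by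
  obtain ⟨α, β, φ, hφ, hn, hx, hy⟩ := h.exists_aequiv_powAdd hN
  rcases le_or_gt ψ.conductor (a + 1) with hc | hc
  · exact ⟨α, β, φ, hφ, by rw [hx, hN.powAdd_gaps_eq hc], hy⟩
  obtain ⟨r, hr⟩ := exists_algEquiv_symm_X_eq (show ψ.conductor - 1 - a ≠ 0 by omega)
    (coeff (ψ.conductor - 1) (powAdd a ψ.gaps α) / a)
  have hr' := (sub_eq_zero.mpr hr) ▸ dvd_zero (X ^ (ψ.conductor - 1 - a + 2) : PowerSeries K)
  have hd := hN.dvd_algEquiv_powAdd_sub h1 hc (mul_div_cancel₀ _ ha) rfl hr'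
  have hχ := hφ.trans (φ.reparam_aequiv r)
  have hn' := hn.reparam r (by omega) hr'
  have hNχ := hχ.hasConductor hN
  obtain ⟨β', hβ'⟩ := hNχ.exists_sub_eq_powAdd hn'.dvd_y
  obtain ⟨θ, hθ, -, hx', hy'⟩ := hn'.exists_aequiv
    (hNχ.mem_ring (by
      rw [hχ.conductor_eq, show (φ.reparam r).x = r (powAdd a ψ.gaps α) from congrArg r hx]
      exact hd)) hβ' (dvd_powAdd_sub _ _ _) (dvd_powAdd_sub _ _ _)
  exact ⟨α, β', θ, hχ.trans hθ, hx', by rw [hy', hχ.gaps_eq]⟩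

theorem aequivTo_X_pow_smallGaps (h : ψ.IsNormalized a b) (hN : ψ.HasConductor)
    (h1 : 1 ∉ ψ.semigroup) (ha : (a : K) ≠ 0) (hb : (b : K) ≠ 0) :
    ∃ β : ℕ → K, ψ.AEquivTo (X ^ a) (powAdd b ψ.smallGaps β) := by
  obtain ⟨β, φ, hφ, hn, hx, hy⟩ := h.exists_aequiv_X_pow_left hN ha
  rcases le_or_gt ψ.conductor (b + 1) with hc | hc
  · exact ⟨β, φ, hφ, hx, by rw [hy, hN.powAdd_gaps_eq hc]⟩
  have hNφ := hφ.hasConductor hN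
  -- `b - a` is smaller than `b` and not a multiple of `a`, so minimality of `b` makes it a gap;
  -- symmetry then makes `c - 1 - (b - a) = a + l` a value.
  have hgap : b - a ∉ φ.semigroup := by
    intro hs
    have := hn.isAdapted.isLeast_not_dvd.2 ⟨hs, fun hd => hn.not_dvd ((Nat.dvd_sub_iff_left
      hn.lt.le dvd_rfl).mp hd)⟩
    have := hn.lt
    have := hn.pos
    omega
  obtain ⟨f, hf, hfo⟩ := conductor_sub_mem_semigroup hNφ (hφ.semigroup_eq ▸ h1) hn.pos.ne' hx hgap
  rw [hφ.conductor_eq] at hfo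
  obtain ⟨l, hl⟩ : ∃ l, l = ψ.conductor - 1 - b := ⟨_, rfl⟩
  have hab := hn.lt
  rw [show ψ.conductor - 1 - (b - a) = a + l by omega, order_eq_natCast_iff] at hfo
  -- Scaled so that the substitution turning `t^a + g` back into `t^a` has the `κ` that cancels the
  -- coefficient of degree `c - 1` in `y`.
  obtain ⟨g, hg⟩ : ∃ g, g = (a * coeff (ψ.conductor - 1) (powAdd b ψ.gaps β) / b /
    coeff (a + l) f) • f := ⟨_, rfl⟩
  have hgd : X ^ (a + l) ∣ g := hg ▸ dvd_smul_right_of_dvd _ hfo.1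
  obtain ⟨r, hrx, hr⟩ := exists_algEquiv_map_eq_X_pow ha (by omega) hgd
  obtain ⟨χ, hχ, hnχ, hxχ, hyχ⟩ := hn.exists_aequiv (u := X ^ a + g) (v := φ.y)
    (by
      rw [hx, sub_add_cancel_left, hg]
      exact φ.ring.neg_mem (φ.ring.smul_mem hf _))
    (by rw [sub_self]; exact zero_mem _)
    (by rw [add_sub_cancel_left]; exact (pow_dvd_pow X (by omega)).trans hgd) hn.dvd_y
  have hκ : b * (coeff (a + l) g / a) = coeff (ψ.conductor - 1) (powAdd b ψ.gaps β) := by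
    rw [hg, coeff_smul, smul_eq_mul, div_mul_cancel₀ _ hfo.2]
    field_simp
  have hd := hN.dvd_algEquiv_powAdd_sub h1 hc hκ hl hr
  have hθ := (hφ.trans hχ).trans (χ.reparam_aequiv r)
  have hNθ := hθ.hasConductor hN
  obtain ⟨θ, hθ', -, hx', hy'⟩ := (hnχ.reparam r (by omega) hr).exists_aequiv (u := X ^ a)
    (v := powAdd b ψ.smallGaps β)
    (by
      rw [show (χ.reparam r).x = X ^ a from (congrArg r hxχ).trans hrx, sub_self]
      exact zero_mem _)
    (hNθ.mem_ring (by
      rw [hθ.conductor_eq, show (χ.reparam r).y = r (powAdd b ψ.gaps β) from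
        congrArg r (hyχ.trans hy)]
      exact hd))
    (by rw [sub_self]; exact dvd_zero _) (dvd_powAdd_sub _ _ _)
  exact ⟨β, θ, hθ.trans hθ', hx', hy'⟩

/-- With the roles exchanged no symmetry is needed: for `l = c - 1 - a` one has `b + l ≥ c`, so
`t^(b+l)` itself lies in the ring and can be added to `y`. -/
theorem aequivTo_smallGaps_X_pow (h : ψ.IsNormalized a b) (hN : ψ.HasConductor)
    (h1 : 1 ∉ ψ.semigroup) (ha : (a : K) ≠ 0) (hb : (b : K) ≠ 0) :
    ∃ α : ℕ → K, ψ.AEquivTo (powAdd a ψ.smallGaps α) (X ^ b) := by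
  obtain ⟨α, φ, hφ, hn, hx, hy⟩ := h.exists_aequiv_X_pow_right hN hb
  rcases le_or_gt ψ.conductor (a + 1) with hc | hc
  · exact ⟨α, φ, hφ, by rw [hx, hN.powAdd_gaps_eq hc], hy⟩
  have hNφ := hφ.hasConductor hN
  obtain ⟨l, hl⟩ : ∃ l, l = ψ.conductor - 1 - a := ⟨_, rfl⟩
  have hab := hn.lt
  obtain ⟨g, hg⟩ : ∃ g, g = (b * coeff (ψ.conductor - 1) (powAdd a ψ.gaps α) / a) •
    (X ^ (b + l) : PowerSeries K) := ⟨_, rfl⟩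
  have hgd : X ^ (b + l) ∣ g := hg ▸ dvd_smul_right_of_dvd _ dvd_rfl
  have hgR : g ∈ φ.ring := hNφ.mem_ring
    ((pow_dvd_pow X (by rw [hφ.conductor_eq]; omega)).trans hgd)
  obtain ⟨r, hry, hr⟩ := exists_algEquiv_map_eq_X_pow hb (by omega) hgd
  obtain ⟨χ, hχ, hnχ, hxχ, hyχ⟩ := hn.exists_aequiv (u := φ.x) (v := X ^ b + g)
    (by rw [sub_self]; exact zero_mem _)
    (by rw [hy, sub_add_cancel_left]; exact φ.ring.neg_mem hgR)
    hn.dvd_x (by rw [add_sub_cancel_left]; exact (pow_dvd_pow X (by omega)).trans hgd)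
  have hκ : a * (coeff (b + l) g / b) = coeff (ψ.conductor - 1) (powAdd a ψ.gaps α) := by
    rw [hg, coeff_smul, smul_eq_mul, coeff_X_pow_self]
    field_simp
  have hd := hN.dvd_algEquiv_powAdd_sub h1 hc hκ hl hr
  have hθ := (hφ.trans hχ).trans (χ.reparam_aequiv r)
  have hNθ := hθ.hasConductor hN
  obtain ⟨θ, hθ', -, hx', hy'⟩ := (hnχ.reparam r (by omega) hr).exists_aequiv
    (u := powAdd a ψ.smallGaps α) (v := X ^ b)
    (hNθ.mem_ring (by
      rw [hθ.conductor_eq, show (χ.reparam r).x = r (powAdd a ψ.gaps α) from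
        congrArg r (hxχ.trans hx)]
      exact hd))
    (by
      rw [show (χ.reparam r).y = X ^ b from (congrArg r hyχ).trans hry, sub_self]
      exact zero_mem _)
    (dvd_powAdd_sub _ _ _) (by rw [sub_self]; exact dvd_zero _)
  exact ⟨α, θ, hθ.trans hθ', hx', hy'⟩

end IsNormalized

theorem IsAdapted.exists_isNormalized {ψ : PlaneParam K} {a b : ℕ} (h : ψ.IsAdapted a b) :
    ∃ φ : PlaneParam K, ψ.AEquiv φ ∧ φ.IsNormalized a b := by
  have scale : ∀ {f : PowerSeries K} {n : ℕ}, f.order = n →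
      X ^ (n + 1) ∣ (coeff n f)⁻¹ • f - X ^ n := by
    intro f n hf
    rw [order_eq_natCast_iff] at hf
    rw [X_pow_succ_dvd_iff]
    exact ⟨dvd_sub (dvd_smul_right_of_dvd _ hf.1) dvd_rfl, by simp [inv_mul_cancel₀ hf.2]⟩
  have hx := scale h.order_x
  have hy := scale h.order_y
  obtain ⟨φ, hφ, hφx, hφy⟩ := h.aequivTo (ψ.ring.smul_mem ψ.x_mem_ring (coeff a ψ.x)⁻¹)
    (ψ.ring.smul_mem ψ.y_mem_ring (coeff b ψ.y)⁻¹) (order_eq_of_dvd_sub_X_pow hx)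
    (order_eq_of_dvd_sub_X_pow hy)
  exact ⟨φ, hφ, { h with dvd_x := hφx ▸ hx, dvd_y := hφy ▸ hy }⟩

end PlaneParam

theorem theorem3p1 {K : Type*} [Field K] [IsAlgClosed K] (p : ℕ) [CharP K p]
    (ψ : PlaneParam K) (hprim : ψ.IsPrimitive) (hsing : 1 ∉ ψ.semigroup) :
    ∃ a b : ℕ,
      -- `a` is the multiplicity, `b` the least value that is not a multiple of `a`
      IsLeast {n | n ∈ ψ.semigroup ∧ n ≠ 0} a ∧
      IsLeast {n | n ∈ ψ.semigroup ∧ ¬ a ∣ n} b ∧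
      a < b ∧ ¬ a ∣ b ∧
      -- comparison with the orders of the given components
      (ψ.x.order < ψ.y.order →
        ψ.x.order = (a : ℕ∞) ∧ ∀ m : ℕ, ψ.y.order = (m : ℕ∞) → ¬ a ∣ m → m = b) ∧
      -- short parametrizations
      (∃ α β : ℕ → K, ψ.AEquivTo
        (PlaneParam.powAdd a ψ.gaps α) (PlaneParam.powAdd b ψ.gaps β)) ∧
      (¬ p ∣ a → ∃ β : ℕ → K, ψ.AEquivTo
        (PowerSeries.X ^ a) (PlaneParam.powAdd b ψ.gaps β)) ∧
      (¬ p ∣ b → ∃ α : ℕ → K, ψ.AEquivTo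
        (PlaneParam.powAdd a ψ.gaps α) (PowerSeries.X ^ b)) ∧
      -- removing the term of order `c - 1` from one component
      (2 < a → ¬ p ∣ b → ∃ α β : ℕ → K, ψ.AEquivTo
        (PlaneParam.powAdd a ψ.gaps α) (PlaneParam.powAdd b ψ.smallGaps β)) ∧
      (2 < a → ¬ p ∣ a → ∃ α β : ℕ → K, ψ.AEquivTo
        (PlaneParam.powAdd a ψ.smallGaps α) (PlaneParam.powAdd b ψ.gaps β)) ∧
      -- the other component a pure power at the same time
      (2 < a → ¬ p ∣ a → ¬ p ∣ b →
        (∃ β : ℕ → K, ψ.AEquivTo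
          (PowerSeries.X ^ a) (PlaneParam.powAdd b ψ.smallGaps β)) ∧
        (∃ α : ℕ → K, ψ.AEquivTo
          (PlaneParam.powAdd a ψ.smallGaps α) (PowerSeries.X ^ b))) := by
  have hN := hprim.hasConductor
  obtain ⟨a, b, φ₀, hφ₀, had⟩ := hN.exists_isAdapted hsing
  obtain ⟨φ, hφ₁, h⟩ := had.exists_isNormalized
  have hφ := hφ₀.trans hφ₁
  have hNφ := hφ.hasConductor hN
  have h1 : 1 ∉ φ.semigroup := hφ.semigroup_eq ▸ hsing
  have hla := h.isAdapted.isLeast_mult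
  have hlb := h.isAdapted.isLeast_not_dvd
  rw [hφ.semigroup_eq] at hla hlb
  have hcast : ∀ {n : ℕ}, ¬ p ∣ n → (n : K) ≠ 0 := fun hn h0 =>
    hn ((CharP.cast_eq_zero_iff K p _).mp h0)
  rw [← hφ.gaps_eq, ← hφ.smallGaps_eq]
  refine ⟨a, b, hla, hlb, h.lt, h.not_dvd, ?_, ?_, ?_, ?_, ?_, ?_, ?_⟩
  · intro hxy
    obtain ⟨a', b', χ, hxa, hχ, h'⟩ := hN.exists_isAdapted_of_le hsing hxy.le
    have hla' := h'.isLeast_mult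
    rw [hχ.semigroup_eq] at hla'
    obtain rfl := hla.unique hla'
    refine ⟨hxa, fun m hm hdvd => ?_⟩
    -- The given components are themselves adapted to `a` and `m`, and least elements are unique.
    have hadψ : ψ.IsAdapted a m :=
      ⟨hxa, hm, h.pos, by rw [hxa, hm] at hxy; exact_mod_cast hxy, hdvd⟩
    exact hadψ.isLeast_not_dvd.unique hlb
  · obtain ⟨α, β, χ, hχ, -, hx, hy⟩ := h.exists_aequiv_powAdd hNφ
    exact ⟨α, β, χ, hφ.trans hχ, hx, hy⟩
  · intro ha
    obtain ⟨β, χ, hχ, -, hx, hy⟩ := h.exists_aequiv_X_pow_left hNφ (hcast ha)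
    exact ⟨β, χ, hφ.trans hχ, hx, hy⟩
  · intro hb
    obtain ⟨α, χ, hχ, -, hx, hy⟩ := h.exists_aequiv_X_pow_right hNφ (hcast hb)
    exact ⟨α, χ, hφ.trans hχ, hx, hy⟩
  · intro _ hb
    obtain ⟨α, β, hαβ⟩ := h.aequivTo_smallGaps_right hNφ h1 (hcast hb)
    exact ⟨α, β, hφ.trans_to hαβ⟩
  · intro _ ha
    obtain ⟨α, β, hαβ⟩ := h.aequivTo_smallGaps_left hNφ h1 (hcast ha)
    exact ⟨α, β, hφ.trans_to hαβ⟩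
  · intro _ ha hb
    obtain ⟨β, hβ⟩ := h.aequivTo_X_pow_smallGaps hNφ h1 (hcast ha) (hcast hb)
    obtain ⟨α, hα⟩ := h.aequivTo_smallGaps_X_pow hNφ h1 (hcast ha) (hcast hb)
    exact ⟨⟨β, hφ.trans_to hβ⟩, α, hφ.trans_to hα⟩
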